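/- **Setting.** For weights $\omega_1,\dots,\omega_d\in\mathbb R^m$ that are entrywise nonnegative with $\omega_1+\dots+\omega_d$ entrywise positive, exponents $p_1,\dots,p_d\in(1,\infty)$ and $s\in[1,\infty)$ let $$\|x\|_{\omega_k,p_k}=\Big(\sum_i(\omega_k)_i|x_i|^{p_k}\Big)^{1/p_k},\qquad \|x\|_{\alpha}=\Big(\sum_{k=1}^d\|x\|_{\omega_k,p_k}^s\Big)^{1/s}\quad(x\in\mathbb R^m).$$ Let likewise $\varpi_1,\dots,\varpi_h\in\mathbb R^n$ be nonnegative with positive sum, $q_1,\dots,q_h\in(1,\infty)$, $t\in[1,\infty)$, put $\|x\|_{\gamma}=\big(\sum_{k=1}^h\|x\|_{\varpi_k,q_k}^t\big)^{1/t}$ on $\mathbb R^n$, and let $\|\cdot\|_\beta$ be the dual norm of $\|\cdot\|_\gamma$, $\|x\|_\beta=\max_{y\ne0}\langle x,y\rangle/\|y\|_\gamma$. For a norm $N$ differentiable away from $0$ let $J_N(x)=\nabla N(x)$ for $x\neq 0$ and $J_N(0)=0$. Let $\|A\|_{\beta\to\alpha}=\max_{x\ne0}\|Ax\|_\alpha/\|x\|_\beta$.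 The power sequence from $x_0$ is obtained by replacing $x_0$ by $x_0/\|x_0\|_\beta$ and iterating $x_{k+1}=\mathcal S_A(x_k)$, where $\mathcal S_A(x)=J_{\beta^*}(A^TJ_\alpha(Ax))$ and $\|\cdot\|_{\beta^*}$ is the dual norm of $\|\cdot\|_\beta$. Let $d_H(x,y)=\ln(M(x/y)M(y/x))$, $M(x/y)=\inf\{C>0:x\le Cy\}$, be Hilbert's projective metric on comparable vectors of the nonnegative orthant ($d_H(0,0)=0$, and $d_H=\infty$ for vectors that are not comparable), let $\kappa_H(F)$ be the smallest Lipschitz constant of $F$ for $d_H$ over pairs of comparable nonnegative vectors, and let $\mathrm{nnz}$ count nonzero entries. **Theorem.** Let $n\ge 1$ and let $A\in\mathbb R^{m\times n}$ be entrywise nonnegative with $A^TA$ irreducible (i.e. the digraph of its positive entries is strongly connected by paths of positive length). Let $$\tau=\kappa_H(A)\,\kappa_H(A^T)\Big(s-1+\sum_{k=1}^d\max\{0,p_k-s\}\Big)\Big(t-1+\sum_{j=1}^h\max\{0,q_j-t\}\Big),$$ $$C(\mathcal S_A)=\sum_{k=1}^d\mathrm{nnz}(\omega_k)+\sum_{k=1}^h\mathrm{nnz}(\varpi_k)+\mathrm{nnz}(A).$$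 Suppose that $\tau<1$ and that $\|\cdot\|_\alpha$ and $\|\cdot\|_\gamma$ are differentiable away from the origin. Then: 1. If $t>1$, then for all $x\in\mathbb R^n$ $$\|x\|_\beta=\min\Big(\sum_{k=1}^h\|u_k\|_{\varpi_k^*,q_k^*}^{t^*}\Big)^{1/t^*},$$ the minimum being over all $u_1+\dots+u_h=x$ with $u_k$ supported in the support of $\varpi_k$, where $r^*=r/(r-1)$ and $(\varpi_k^*)_i=(\varpi_k)_i^{1-q_k^*}$ if $(\varpi_k)_i>0$, $(\varpi_k^*)_i=0$ otherwise. The maximum defining $\|A\|_{\beta\to\alpha}$ is attained. 2. For all $x\in\mathbb R^n$, $\mathcal S_A(x)=G_{\varpi,q,t}\big(A^TG_{\omega,p,s}(Ax)\big)$, where $$G_{\omega,p,s}(x)=\|x\|_\alpha^{1-s}\sum_{k=1}^d\|x\|_{\omega_k,p_k}^{s-p_k}\,\mathrm{diag}(\omega_k)\,\Phi_{p_k}(x),\qquad \Phi_p(x)_i=|x_i|^{p-2}x_i$$ (terms in which $\Phi_p(x)_i=0$ or $(\omega_k)_i=0$ being read as $0$), and $G_{\varpi,q,t}$ is defined in the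 same way with $\|\cdot\|_\gamma$. 3. For every entrywise positive $x_0$, the norm $\|A\|_{\beta\to\alpha}$ is approximated to precision $\epsilon$ by the power sequence in $\mathcal O(C(\mathcal S_A)\ln(1/\epsilon))$ arithmetic operations. Precisely: there is an absolute constant $c$ such that for every $k\ge1$ the vector $x_k$ and the number $\|Ax_k\|_\alpha$ are computed from the entries of $A,\omega,\varpi,x_0$ and the exponents with at most $c\,C(\mathcal S_A)\,k$ operations $+,-,\times,/$ and real powers, by a straight-line program that depends only on $m,n,d,h,k$ and the zero patterns of $A,\omega,\varpi$ and that never divides by zero, takes a power of a negative number, or takes a nonpositive power of zero; and there is a constant $K>0$ independent of $\epsilon$ such that for all $\epsilon\in(0,1/2]$ there is $k\geq 1$ with $k\le K\ln(1/\epsilon)$, so that the program for $x_k$ uses at most $c\,C(\mathcal S_A)\,K\ln(1/\epsilon)$ operations, and $$\|A\|_{\beta\to\alpha}-\epsilon\le\|Ax_l\|_\alpha\le\|A\|_{\beta\to\alpha}\qquad\text{for all }l\ge k .$$ -/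

import Mathlib

open scoped Matrix ENNReal

noncomputable section

/-! ### Hilbert's projective metric and the Birkhoff contraction ratio -/

/-- Comparability `x ∼ y` of vectors of the nonnegative orthant. -/
def Comparable {n : ℕ} (x y : Fin n → ℝ) : Prop :=
  ∃ c C : ℝ, 0 < c ∧ 0 < C ∧ c • y ≤ x ∧ x ≤ C • y

/-- `M(x/y) = inf {C > 0 : x ≤ C y}`. -/
def coneM {n : ℕ} (x y : Fin n → ℝ) : ℝ :=
  sInf {C : ℝ | 0 < C ∧ x ≤ C • y}

open Classical in
/-- Hilbert's projective metric on the nonnegative orthant, with values in `[0, ∞]`. -/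
def hilbertDist {n : ℕ} (x y : Fin n → ℝ) : ℝ≥0∞ :=
  if x = 0 ∧ y = 0 then 0
  else if Comparable x y then ENNReal.ofReal (Real.log (coneM x y * coneM y x))
  else ⊤

/-- The Birkhoff contraction ratio `κ_H(F) ∈ [0, ∞]` of a map `F` between nonnegative orthants:
its smallest Lipschitz constant for the Hilbert metric. -/
def birkhoffRatio {n m : ℕ} (F : (Fin n → ℝ) → (Fin m → ℝ)) : ℝ≥0∞ :=
  sInf {C : ℝ≥0∞ | 0 < C ∧ C < ⊤ ∧ ∀ x y : Fin n → ℝ, 0 ≤ x → 0 ≤ y → Comparable x y →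
    hilbertDist (F x) (F y) ≤ C * hilbertDist x y}

/-! ### Norms, induced matrix norms and the power method -/

/-- The dual `‖x‖_* = max_{y ≠ 0} ⟨x, y⟩ / ‖y‖` of a norm `N`. -/
def dualNorm {n : ℕ} (N : (Fin n → ℝ) → ℝ) (x : Fin n → ℝ) : ℝ :=
  sSup {r : ℝ | ∃ y : Fin n → ℝ, y ≠ 0 ∧ r = (x ⬝ᵥ y) / N y}

/-- The set of quotients `α(Ax) / N(x)`, `x ≠ 0`. -/
def normQuotients {m n : ℕ} (A : Matrix (Fin m) (Fin n) ℝ)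
    (N : (Fin n → ℝ) → ℝ) (α : (Fin m → ℝ) → ℝ) : Set ℝ :=
  {r : ℝ | ∃ x : Fin n → ℝ, x ≠ 0 ∧ r = α (A *ᵥ x) / N x}

/-- The induced matrix norm `‖A‖_{N → α} = max_{x ≠ 0} α(Ax) / N(x)`. -/
def inducedNorm {m n : ℕ} (A : Matrix (Fin m) (Fin n) ℝ)
    (N : (Fin n → ℝ) → ℝ) (α : (Fin m → ℝ) → ℝ) : ℝ :=
  sSup (normQuotients A N α)

/-- A norm is differentiable if it is differentiable away from the origin. -/
def NormDifferentiable {n : ℕ} (N : (Fin n → ℝ) → ℝ) : Prop :=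
  ∀ x : Fin n → ℝ, x ≠ 0 → DifferentiableAt ℝ N x

open Classical in
/-- The map `J_N` of a differentiable norm `N`: the gradient of `N` at `x ≠ 0`, and `J_N(0) = 0`. -/
def normGradient {n : ℕ} (N : (Fin n → ℝ) → ℝ) (x : Fin n → ℝ) : Fin n → ℝ :=
  if x = 0 then 0 else fun i => fderiv ℝ N x (Pi.single i 1)

/-- The iterator `S_A(x) = J_{N_*}(Aᵀ J_α(A x))` of the power method for `‖A‖_{N → α}`,
where `N_*` is the dual of the norm `N` of the domain. -/
def powerMap {m n : ℕ} (A : Matrix (Fin m) (Fin n) ℝ)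
    (N : (Fin n → ℝ) → ℝ) (α : (Fin m → ℝ) → ℝ) (x : Fin n → ℝ) : Fin n → ℝ :=
  normGradient (dualNorm N) (Aᵀ *ᵥ normGradient α (A *ᵥ x))

/-- The power sequence: the starting point is normalized, then `x_{k+1} = S_A(x_k)`. -/
def powerSeq {m n : ℕ} (A : Matrix (Fin m) (Fin n) ℝ)
    (N : (Fin n → ℝ) → ℝ) (α : (Fin m → ℝ) → ℝ) (x₀ : Fin n → ℝ) : ℕ → Fin n → ℝ
  | 0 => (N x₀)⁻¹ • x₀
  | k + 1 => powerMap A N α (powerSeq A N α x₀ k)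

/-! ### Sums of weighted `ℓ^p` norms -/

/-- The weighted `ℓ^p` seminorm `‖x‖_{ω,p} = (∑ i, ω i |x i|^p)^(1/p)`. -/
def wNorm {n : ℕ} (ω : Fin n → ℝ) (p : ℝ) (x : Fin n → ℝ) : ℝ :=
  (∑ i, ω i * |x i| ^ p) ^ (1 / p)

/-- The norm `(∑ k, ‖x‖_{ω_k,p_k}^s)^(1/s)`. -/
def sumNorm {n d : ℕ} (ω : Fin d → Fin n → ℝ) (p : Fin d → ℝ) (s : ℝ) (x : Fin n → ℝ) : ℝ :=
  (∑ k, wNorm (ω k) (p k) x ^ s) ^ (1 / s)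

/-- The explicit formula
`‖x‖^{1-s} ∑ k, ‖x‖_{ω_k,p_k}^{s-p_k} diag(ω_k) Φ_{p_k}(x)`, `Φ_p(x)_i = |x_i|^{p-2} x_i`. -/
def sumNormGrad {n d : ℕ} (ω : Fin d → Fin n → ℝ) (p : Fin d → ℝ) (s : ℝ)
    (x : Fin n → ℝ) : Fin n → ℝ := fun i =>
  sumNorm ω p s x ^ (1 - s) *
    ∑ k, wNorm (ω k) (p k) x ^ (s - p k) * (ω k i * (|x i| ^ (p k - 2) * x i))

/-- The dual weights: `ω_i^{1-p^*}` where `ω_i > 0`, and `0` where `ω_i = 0`. -/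
def dualWeight {n : ℕ} (ω : Fin n → ℝ) (p : ℝ) : Fin n → ℝ := fun i =>
  if 0 < ω i then ω i ^ (1 - p.conjExponent) else 0

/-- The values `(∑ k, ‖u_k‖_{w_k,r_k}^v)^(1/v)` over all decompositions `x = u_1 + ⋯ + u_h`
in which `u_k` is supported where the weight `w_k` does not vanish. -/
def splitValues {n h : ℕ} (w : Fin h → Fin n → ℝ) (r : Fin h → ℝ) (v : ℝ)
    (x : Fin n → ℝ) : Set ℝ :=
  {a : ℝ | ∃ u : Fin h → Fin n → ℝ, ∑ k, u k = x ∧ (∀ k i, w k i = 0 → u k i = 0) ∧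
    a = (∑ k, wNorm (w k) (r k) (u k) ^ v) ^ (1 / v)}

/-- `s - 1 + ∑ k, max {0, p_k - s}`. -/
def expoFactor {d : ℕ} (p : Fin d → ℝ) (s : ℝ) : ℝ :=
  s - 1 + ∑ k, max 0 (p k - s)

/-- The contraction bound `τ`. -/
def tauBound {m n d h : ℕ} (A : Matrix (Fin m) (Fin n) ℝ) (p : Fin d → ℝ) (s : ℝ)
    (q : Fin h → ℝ) (t : ℝ) : ℝ≥0∞ :=
  birkhoffRatio (fun x : Fin n → ℝ => A *ᵥ x) * birkhoffRatio (fun y : Fin m → ℝ => Aᵀ *ᵥ y) *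
    ENNReal.ofReal (expoFactor p s) * ENNReal.ofReal (expoFactor q t)

/-! ### Supports and the cost `C(S_A)` -/

open Classical in
/-- The set of indices at which a vector does not vanish. -/
def vecSupport {n : ℕ} (ω : Fin n → ℝ) : Finset (Fin n) :=
  Finset.univ.filter fun i => ω i ≠ 0

open Classical in
/-- The set of positions of the nonzero entries of a matrix. -/
def matSupport {m n : ℕ} (A : Matrix (Fin m) (Fin n) ℝ) : Finset (Fin m × Fin n) :=
  Finset.univ.filter fun e => A e.1 e.2 ≠ 0

/-- `C(S_A) = ∑ nnz(ω_i) + ∑ nnz(ϖ_i) + nnz(A)`. -/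
def iterCost {m n d h : ℕ} (A : Matrix (Fin m) (Fin n) ℝ) (ω : Fin d → Fin m → ℝ)
    (ϖ : Fin h → Fin n → ℝ) : ℕ :=
  (∑ k, (vecSupport (ω k)).card) + (∑ k, (vecSupport (ϖ k)).card) + (matSupport A).card

/-! ### Straight-line arithmetic programs over the reals -/

/-- The arithmetic operations, each of unit cost; `pow` is the real power `a ^ b`. -/
inductive ArithOp
  | add | sub | mul | div | pow

/-- Partial semantics: no division by zero, no power of a negative number, and no power of zero
with an exponent that is not positive. -/
def ArithOp.eval (o : ArithOp) (a b : ℝ) : Option ℝ :=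
  open Classical in
  match o with
  | .add => some (a + b)
  | .sub => some (a - b)
  | .mul => some (a * b)
  | .div => if b = 0 then none else some (a / b)
  | .pow => if 0 < a ∨ (a = 0 ∧ 0 < b) then some (a ^ b) else none

/-- An operand is an input, the result of the `k`-th operation, or a natural number literal. -/
inductive Operand (ι : Type)
  | inp (i : ι)
  | reg (k : ℕ)
  | lit (c : ℕ)

/-- The value of an operand, given the inputs and the list of the results obtained so far. -/
def Operand.eval {ι : Type} (inp : ι → ℝ) (regs : List ℝ) : Operand ι → Option ℝ
  | .inp i => some (inp i)
  | .reg k => regs[k]?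
  | .lit c => some (c : ℝ)

/-- An instruction applies one arithmetic operation to two operands. -/
structure Instr (ι : Type) where
  op : ArithOp
  fst : Operand ι
  snd : Operand ι

/-- A straight-line program; its length is the number of arithmetic operations it performs. -/
abbrev Program (ι : Type) := List (Instr ι)

/-- Run a program: the result of each operation is appended to the list of results; the run fails
(`none`) if an operation is undefined. -/
def Program.run {ι : Type} (inp : ι → ℝ) : Program ι → List ℝ → Option (List ℝ)
  | [], regs => some regs
  | I :: P, regs =>
    (I.fst.eval inp regs).bind fun a =>
      (I.snd.eval inp regs).bind fun b =>
        (I.op.eval a b).bind fun v => Program.run inp P (regs ++ [v])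

/-- A program outputs the list `out` if it runs without failure and `out` is the list of the
results of its last operations. -/
def Program.Outputs {ι : Type} (P : Program ι) (inp : ι → ℝ) (out : List ℝ) : Prop :=
  ∃ regs : List ℝ, Program.run inp P [] = some regs ∧ out <:+ regs

/-- The names of the inputs of the power method: the entries of `A`, the weights, the exponents
and the entries of the starting point. -/
inductive InputName (m n d h : ℕ) : Type
  | A (i : Fin m) (j : Fin n)
  | ω (k : Fin d) (i : Fin m)
  | p (k : Fin d)
  | s
  | ϖ (k : Fin h) (j : Fin n)
  | q (k : Fin h)
  | t
  | x₀ (j : Fin n)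

/-- The values of the inputs. -/
def inputValue {m n d h : ℕ} (A : Matrix (Fin m) (Fin n) ℝ)
    (ω : Fin d → Fin m → ℝ) (p : Fin d → ℝ) (s : ℝ)
    (ϖ : Fin h → Fin n → ℝ) (q : Fin h → ℝ) (t : ℝ) (x₀ : Fin n → ℝ) :
    InputName m n d h → ℝ
  | .A i j => A i j
  | .ω k i => ω k i
  | .p k => p k
  | .s => s
  | .ϖ k j => ϖ k j
  | .q k => q k
  | .t => t
  | .x₀ j => x₀ j

end

/-- A norm on `ℝⁿ` that is monotone in the absolute values of the entries. -/
structure IsMonotoneNorm {n : ℕ} (N : (Fin n → ℝ) → ℝ) : Prop where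
  add_le : ∀ x y, N (x + y) ≤ N x + N y
  smul : ∀ (c : ℝ) x, N (c • x) = |c| * N x
  eq_zero : ∀ x, N x = 0 → x = 0
  mono : ∀ x y, (∀ i, |x i| ≤ |y i|) → N x ≤ N y

namespace IsMonotoneNorm

variable {n : ℕ} {N : (Fin n → ℝ) → ℝ}

theorem map_zero (hN : IsMonotoneNorm N) : N 0 = 0 := by
  simpa using hN.smul 0 0

theorem nonneg (hN : IsMonotoneNorm N) (x : Fin n → ℝ) : 0 ≤ N x := by
  rw [← hN.map_zero]
  exact hN.mono _ _ fun i => by simp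

theorem pos (hN : IsMonotoneNorm N) {x : Fin n → ℝ} (hx : x ≠ 0) : 0 < N x :=
  lt_of_le_of_ne (hN.nonneg x) fun h => hx (hN.eq_zero x h.symm)

theorem smul_of_nonneg (hN : IsMonotoneNorm N) {c : ℝ} (hc : 0 ≤ c) (x : Fin n → ℝ) :
    N (c • x) = c * N x := by
  rw [hN.smul, abs_of_nonneg hc]

theorem convexOn (hN : IsMonotoneNorm N) : ConvexOn ℝ Set.univ N := by
  refine ⟨convex_univ, fun x _ y _ a b ha hb _ => ?_⟩
  calc N (a • x + b • y) ≤ N (a • x) + N (b • y) := hN.add_le _ _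
    _ = a • N x + b • N y := by
      rw [hN.smul_of_nonneg ha, hN.smul_of_nonneg hb, smul_eq_mul, smul_eq_mul]

theorem continuous (hN : IsMonotoneNorm N) : Continuous N := by
  rw [← continuousOn_univ]
  exact hN.convexOn.continuousOn isOpen_univ

theorem le_of_le (hN : IsMonotoneNorm N) {x y : Fin n → ℝ} (hx : 0 ≤ x) (hxy : x ≤ y) :
    N x ≤ N y :=
  hN.mono _ _ fun i => by
    rw [abs_of_nonneg (hx i), abs_of_nonneg ((hx i).trans (hxy i))]
    exact hxy i

/-- The quotient of a nonnegatively homogeneous continuous function by a norm attains its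
maximum. -/
theorem exists_max_quotient (hN : IsMonotoneNorm N) (hn : 0 < n) {f : (Fin n → ℝ) → ℝ}
    (hf : Continuous f) (hh : ∀ c : ℝ, 0 ≤ c → ∀ x, f (c • x) = c * f x) :
    ∃ y, N y = 1 ∧ ∀ x, x ≠ 0 → f x / N x ≤ f y := by
  have hne : (Metric.sphere (0 : Fin n → ℝ) 1).Nonempty := by
    have : Nonempty (Fin n) := ⟨⟨0, hn⟩⟩
    exact NormedSpace.sphere_nonempty.mpr zero_le_one
  have h0 : ∀ x ∈ Metric.sphere (0 : Fin n → ℝ) 1, x ≠ 0 := by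
    rintro x hx rfl
    simp at hx
  obtain ⟨y, hy, hmax⟩ := (isCompact_sphere (0 : Fin n → ℝ) 1).exists_isMaxOn hne
    (f := fun x => f x / N x)
    (hf.continuousOn.div hN.continuous.continuousOn fun x hx => (hN.pos (h0 x hx)).ne')
  have hNy := hN.pos (h0 y hy)
  refine ⟨(N y)⁻¹ • y, ?_, fun x hx => ?_⟩
  · rw [hN.smul_of_nonneg (inv_nonneg.mpr hNy.le), inv_mul_cancel₀ hNy.ne']
  · have hx' : 0 < ‖x‖ := norm_pos_iff.mpr hx
    have key : f (‖x‖⁻¹ • x) / N (‖x‖⁻¹ • x) ≤ f y / N y :=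
      hmax (show ‖x‖⁻¹ • x ∈ Metric.sphere (0 : Fin n → ℝ) 1 by
        rw [mem_sphere_zero_iff_norm, norm_smul, norm_inv, norm_norm, inv_mul_cancel₀ hx'.ne'])
    rw [hh _ (inv_nonneg.mpr hx'.le), hN.smul_of_nonneg (inv_nonneg.mpr hx'.le),
      mul_div_mul_left _ _ (inv_ne_zero hx'.ne')] at key
    rw [hh _ (inv_nonneg.mpr hNy.le), inv_mul_eq_div]
    exact key

theorem exists_dualNorm_eq (hN : IsMonotoneNorm N) (hn : 0 < n) (x : Fin n → ℝ) :
    ∃ y, N y = 1 ∧ x ⬝ᵥ y = dualNorm N x ∧ ∀ z, x ⬝ᵥ z ≤ dualNorm N x * N z := by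
  obtain ⟨y, hy, hmax⟩ := hN.exists_max_quotient hn (f := fun y => x ⬝ᵥ y)
    (by unfold dotProduct; fun_prop) (fun c _ z => by simp)
  have hy0 : y ≠ 0 := by
    rintro rfl
    rw [hN.map_zero] at hy
    exact zero_ne_one hy
  have hgr : IsGreatest {r : ℝ | ∃ y : Fin n → ℝ, y ≠ 0 ∧ r = (x ⬝ᵥ y) / N y} (x ⬝ᵥ y) := by
    refine ⟨⟨y, hy0, by rw [hy, div_one]⟩, ?_⟩
    rintro r ⟨z, hz, rfl⟩
    exact hmax z hz
  have he : dualNorm N x = x ⬝ᵥ y := hgr.csSup_eq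
  refine ⟨y, hy, he.symm, fun z => ?_⟩
  rcases eq_or_ne z 0 with rfl | hz
  · simp [hN.map_zero]
  · rw [he]
    exact (div_le_iff₀ (hN.pos hz)).mp (hmax z hz)

theorem dotProduct_le (hN : IsMonotoneNorm N) (x y : Fin n → ℝ) :
    x ⬝ᵥ y ≤ dualNorm N x * N y := by
  rcases Nat.eq_zero_or_pos n with rfl | hn
  · rw [Subsingleton.elim y 0, hN.map_zero]
    simp
  · exact (hN.exists_dualNorm_eq hn x).choose_spec.2.2 y

theorem dualNorm_le (hN : IsMonotoneNorm N) (hn : 0 < n) {x : Fin n → ℝ} {c : ℝ}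
    (h : ∀ y, x ⬝ᵥ y ≤ c * N y) : dualNorm N x ≤ c := by
  obtain ⟨y, hy, hxy, _⟩ := hN.exists_dualNorm_eq hn x
  rw [← hxy]
  simpa [hy] using h y

protected theorem dualNorm (hN : IsMonotoneNorm N) (hn : 0 < n) :
    IsMonotoneNorm (dualNorm N) := by
  have hle : ∀ (c : ℝ) x, dualNorm N (c • x) ≤ |c| * dualNorm N x := fun c x => by
    refine hN.dualNorm_le hn fun y => ?_
    calc (c • x) ⬝ᵥ y = x ⬝ᵥ (c • y) := by simp
      _ ≤ dualNorm N x * N (c • y) := hN.dotProduct_le _ _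
      _ = |c| * dualNorm N x * N y := by rw [hN.smul]; ring
  refine ⟨fun x y => ?_, fun c x => ?_, fun x hx => ?_, fun x y hxy => ?_⟩
  · refine hN.dualNorm_le hn fun z => ?_
    rw [add_dotProduct, add_mul]
    exact add_le_add (hN.dotProduct_le x z) (hN.dotProduct_le y z)
  · refine le_antisymm (hle c x) ?_
    rcases eq_or_ne c 0 with rfl | hc
    · obtain ⟨y, _, hy, _⟩ := hN.exists_dualNorm_eq hn ((0 : ℝ) • x)
      rw [← hy]
      simp
    · have h := hle c⁻¹ (c • x)
      rw [smul_smul, inv_mul_cancel₀ hc, one_smul, abs_inv] at h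
      have hc' := abs_pos.mpr hc
      calc |c| * dualNorm N x ≤ |c| * (|c|⁻¹ * dualNorm N (c • x)) := by gcongr
        _ = dualNorm N (c • x) := by field_simp
  · have h := hN.dotProduct_le x x
    rw [hx, zero_mul] at h
    exact dotProduct_self_eq_zero.mp (le_antisymm h (Finset.sum_nonneg fun i _ => mul_self_nonneg _))
  · obtain ⟨z, hz, hxz, _⟩ := hN.exists_dualNorm_eq hn x
    rw [← hxz]
    set w : Fin n → ℝ := fun i => if 0 ≤ y i then |z i| else -|z i| with hw
    have h1 : x ⬝ᵥ z ≤ y ⬝ᵥ w := by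
      refine Finset.sum_le_sum fun i _ => ?_
      have : y i * w i = |y i| * |z i| := by
        simp only [hw]
        split_ifs with h
        · rw [abs_of_nonneg h]
        · rw [abs_of_neg (not_le.mp h)]; ring
      rw [this]
      exact (le_abs_self _).trans ((abs_mul _ _).le.trans
        (mul_le_mul_of_nonneg_right (hxy i) (abs_nonneg _)))
    have h2 : N w ≤ 1 := by
      rw [← hz]
      refine hN.mono _ _ fun i => ?_
      simp only [hw]
      split_ifs <;> simp
    have h3 := hN.dotProduct_le y w
    have h4 : 0 ≤ dualNorm N y := by
      have := hN.dotProduct_le y y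
      rcases eq_or_ne y 0 with rfl | hy
      · obtain ⟨y', _, hy', _⟩ := hN.exists_dualNorm_eq hn (0 : Fin n → ℝ)
        rw [← hy']
        simp
      · have h5 : 0 ≤ y ⬝ᵥ y := Finset.sum_nonneg fun i _ => mul_self_nonneg _
        exact nonneg_of_mul_nonneg_left (h5.trans this) (hN.pos hy)
    nlinarith [hN.nonneg w]

/-! #### Gradients -/

theorem hasDerivAt_line (hd : NormDifferentiable N) {x : Fin n → ℝ} (hx : x ≠ 0)
    (z : Fin n → ℝ) :
    HasDerivAt (fun r : ℝ => N (x + r • z)) (normGradient N x ⬝ᵥ z) 0 := by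
  have h1 : HasDerivAt (fun r : ℝ => N (x + r • z)) (fderiv ℝ N x z) 0 := by
    have h := (hd x hx).hasFDerivAt.hasLineDerivAt z
    simpa [HasLineDerivAt] using h
  have h2 : fderiv ℝ N x z = normGradient N x ⬝ᵥ z := by
    conv_lhs => rw [← Finset.univ_sum_single z]
    rw [map_sum]
    refine Finset.sum_congr rfl fun i _ => ?_
    have : (Pi.single i (z i) : Fin n → ℝ) = z i • Pi.single i 1 := by
      rw [← Pi.single_smul, smul_eq_mul, mul_one]
    rw [this, map_smul, normGradient, if_neg hx, smul_eq_mul, mul_comm]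
  rwa [h2] at h1

theorem normGradient_dotProduct_self (hN : IsMonotoneNorm N) (hd : NormDifferentiable N)
    {x : Fin n → ℝ} (hx : x ≠ 0) : normGradient N x ⬝ᵥ x = N x := by
  have h1 := hasDerivAt_line hd hx x
  have h2 : HasDerivAt (fun r : ℝ => N (x + r • x)) (N x) 0 := by
    have h : HasDerivAt (fun r : ℝ => (1 + r) * N x) (1 * N x) 0 :=
      ((hasDerivAt_id (0 : ℝ)).const_add 1).mul_const _
    rw [one_mul] at h
    refine h.congr_of_eventuallyEq ?_
    filter_upwards [eventually_gt_nhds (show (-1 : ℝ) < 0 by norm_num)] with r hr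
    rw [← hN.smul_of_nonneg (by linarith : 0 ≤ 1 + r), add_smul, one_smul]
  exact h1.unique h2

theorem eq_normGradient (hd : NormDifferentiable N)
    {x y : Fin n → ℝ} (hx : x ≠ 0) (h1 : y ⬝ᵥ x = N x) (h2 : ∀ z, y ⬝ᵥ z ≤ N z) :
    y = normGradient N x := by
  have key : ∀ z, y ⬝ᵥ z = normGradient N x ⬝ᵥ z := fun z => by
    have hder : HasDerivAt (fun r : ℝ => N (x + r • z) - y ⬝ᵥ (x + r • z))
        (normGradient N x ⬝ᵥ z - y ⬝ᵥ z) 0 := by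
      refine (hasDerivAt_line hd hx z).sub ?_
      have h : HasDerivAt (fun r : ℝ => y ⬝ᵥ x + r * (y ⬝ᵥ z)) (1 * (y ⬝ᵥ z)) 0 :=
        ((hasDerivAt_id (0 : ℝ)).mul_const _).const_add _
      simpa [dotProduct_add, dotProduct_smul] using h
    have hmin : IsLocalMin (fun r : ℝ => N (x + r • z) - y ⬝ᵥ (x + r • z)) 0 := by
      refine Filter.Eventually.of_forall fun r => ?_
      simp only [zero_smul, add_zero, h1, sub_self]
      exact sub_nonneg.mpr (h2 _)
    have := hmin.hasDerivAt_eq_zero hder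
    linarith
  funext i
  simpa using key (Pi.single i 1)

theorem normGradient_dotProduct_le (hN : IsMonotoneNorm N) (hd : NormDifferentiable N)
    {x : Fin n → ℝ} (hx : x ≠ 0) (z : Fin n → ℝ) : normGradient N x ⬝ᵥ z ≤ N z := by
  have hder : HasDerivWithinAt (fun r : ℝ => N (x + r • z)) (normGradient N x ⬝ᵥ z)
      (Set.Ioi 0) 0 := (hasDerivAt_line hd hx z).hasDerivWithinAt
  rw [hasDerivWithinAt_iff_tendsto_slope' (by simp)] at hder
  refine le_of_tendsto hder ?_
  filter_upwards [self_mem_nhdsWithin] with r hr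
  have hr : 0 < r := hr
  rw [slope_def_field, zero_smul, add_zero, sub_zero, div_le_iff₀ hr]
  have := hN.add_le x (r • z)
  rw [hN.smul_of_nonneg hr.le] at this
  linarith

theorem normGradient_smul (hN : IsMonotoneNorm N) (hd : NormDifferentiable N)
    {c : ℝ} (hc : 0 < c) (x : Fin n → ℝ) : normGradient N (c • x) = normGradient N x := by
  rcases eq_or_ne x 0 with rfl | hx
  · rw [smul_zero]
  · refine (eq_normGradient hd (smul_ne_zero hc.ne' hx) ?_
      (hN.normGradient_dotProduct_le hd hx)).symm
    rw [dotProduct_smul, hN.normGradient_dotProduct_self hd hx, hN.smul_of_nonneg hc.le,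
      smul_eq_mul]

theorem dualNorm_normGradient (hN : IsMonotoneNorm N) (hd : NormDifferentiable N)
    (hn : 0 < n) {x : Fin n → ℝ} (hx : x ≠ 0) : dualNorm N (normGradient N x) = 1 := by
  refine le_antisymm (hN.dualNorm_le hn fun y => ?_) ?_
  · rw [one_mul]
    exact hN.normGradient_dotProduct_le hd hx y
  · have h := hN.dotProduct_le (normGradient N x) x
    rw [hN.normGradient_dotProduct_self hd hx] at h
    exact (le_mul_iff_one_le_left (hN.pos hx)).mp h

theorem dualNorm_dualNorm (hN : IsMonotoneNorm N) (hd : NormDifferentiable N)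
    (hn : 0 < n) : dualNorm (dualNorm N) = N := by
  funext x
  have hD := hN.dualNorm hn
  rcases eq_or_ne x 0 with rfl | hx
  · rw [(hD.dualNorm hn).map_zero, hN.map_zero]
  · refine le_antisymm (hD.dualNorm_le hn fun y => ?_) ?_
    · rw [dotProduct_comm, mul_comm]
      exact hN.dotProduct_le y x
    · have h := hD.dotProduct_le x (normGradient N x)
      rwa [dotProduct_comm, hN.normGradient_dotProduct_self hd hx,
        hN.dualNorm_normGradient hd hn hx, mul_one] at h

end IsMonotoneNorm

section WNorm

variable {n : ℕ} {ω : Fin n → ℝ} {p : ℝ}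

theorem wSum_nonneg (hω : ∀ i, 0 ≤ ω i) (p : ℝ) (x : Fin n → ℝ) :
    0 ≤ ∑ i, ω i * |x i| ^ p :=
  Finset.sum_nonneg fun i _ => mul_nonneg (hω i) (Real.rpow_nonneg (abs_nonneg _) _)

theorem wNorm_nonneg (hω : ∀ i, 0 ≤ ω i) (p : ℝ) (x : Fin n → ℝ) : 0 ≤ wNorm ω p x :=
  Real.rpow_nonneg (wSum_nonneg hω p x) _

theorem wNorm_rpow (hω : ∀ i, 0 ≤ ω i) (hp : p ≠ 0) (x : Fin n → ℝ) :
    wNorm ω p x ^ p = ∑ i, ω i * |x i| ^ p := by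
  rw [wNorm, ← Real.rpow_mul (wSum_nonneg hω p x), one_div_mul_cancel hp, Real.rpow_one]

theorem wNorm_eq_zero_iff (hω : ∀ i, 0 ≤ ω i) (hp : 0 < p) {x : Fin n → ℝ} :
    wNorm ω p x = 0 ↔ ∀ i, ω i = 0 ∨ x i = 0 := by
  rw [wNorm, Real.rpow_eq_zero (wSum_nonneg hω p x) (by positivity),
    Finset.sum_eq_zero_iff_of_nonneg
      fun i _ => mul_nonneg (hω i) (Real.rpow_nonneg (abs_nonneg _) _)]
  simp [Real.rpow_eq_zero, hp.ne']

theorem wNorm_pos (hω : ∀ i, 0 ≤ ω i) (hp : 0 < p) {x : Fin n → ℝ} {i : Fin n}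
    (hi : 0 < ω i) (hx : x i ≠ 0) : 0 < wNorm ω p x := by
  refine lt_of_le_of_ne (wNorm_nonneg hω p x) fun h => ?_
  rcases (wNorm_eq_zero_iff hω hp).mp h.symm i with h | h
  exacts [hi.ne' h, hx h]

theorem wNorm_smul (hω : ∀ i, 0 ≤ ω i) (hp : p ≠ 0) (c : ℝ) (x : Fin n → ℝ) :
    wNorm ω p (c • x) = |c| * wNorm ω p x := by
  have h : ∑ i, ω i * |(c • x) i| ^ p = |c| ^ p * ∑ i, ω i * |x i| ^ p := by
    rw [Finset.mul_sum]
    refine Finset.sum_congr rfl fun i _ => ?_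
    rw [Pi.smul_apply, smul_eq_mul, abs_mul, Real.mul_rpow (abs_nonneg _) (abs_nonneg _)]
    ring
  rw [wNorm, h, Real.mul_rpow (Real.rpow_nonneg (abs_nonneg _) _) (wSum_nonneg hω p x),
    ← Real.rpow_mul (abs_nonneg _), mul_one_div_cancel hp, Real.rpow_one, wNorm]

theorem wNorm_mono (hω : ∀ i, 0 ≤ ω i) (hp : 0 < p) {x y : Fin n → ℝ}
    (h : ∀ i, |x i| ≤ |y i|) : wNorm ω p x ≤ wNorm ω p y :=
  Real.rpow_le_rpow (wSum_nonneg hω p x)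
    (Finset.sum_le_sum fun i _ => mul_le_mul_of_nonneg_left
      (Real.rpow_le_rpow (abs_nonneg _) (h i) hp.le) (hω i)) (by positivity)

theorem wNorm_add_le (hω : ∀ i, 0 ≤ ω i) (hp : 1 ≤ p) (x y : Fin n → ℝ) :
    wNorm ω p (x + y) ≤ wNorm ω p x + wNorm ω p y := by
  have hp0 : p ≠ 0 := by positivity
  have key : ∀ z : Fin n → ℝ, ∑ i, |ω i ^ (1 / p) * z i| ^ p = ∑ i, ω i * |z i| ^ p :=
    fun z => Finset.sum_congr rfl fun i _ => by
      rw [abs_mul, abs_of_nonneg (Real.rpow_nonneg (hω i) _),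
        Real.mul_rpow (Real.rpow_nonneg (hω i) _) (abs_nonneg _), ← Real.rpow_mul (hω i),
        one_div_mul_cancel hp0, Real.rpow_one]
  have h := Real.Lp_add_le Finset.univ (fun i => ω i ^ (1 / p) * x i)
    (fun i => ω i ^ (1 / p) * y i) hp
  simp only [← mul_add] at h
  rwa [key x, key y, key fun i => x i + y i] at h

end WNorm

section SumNorm

variable {n d : ℕ} {ω : Fin d → Fin n → ℝ} {p : Fin d → ℝ} {s : ℝ}

theorem sumNorm_sum_nonneg (hω : ∀ k i, 0 ≤ ω k i) (p : Fin d → ℝ) (s : ℝ) (x : Fin n → ℝ) :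
    0 ≤ ∑ k, wNorm (ω k) (p k) x ^ s :=
  Finset.sum_nonneg fun k _ => Real.rpow_nonneg (wNorm_nonneg (hω k) _ _) _

theorem sumNorm_nonneg (hω : ∀ k i, 0 ≤ ω k i) (p : Fin d → ℝ) (s : ℝ) (x : Fin n → ℝ) :
    0 ≤ sumNorm ω p s x :=
  Real.rpow_nonneg (sumNorm_sum_nonneg hω p s x) _

theorem sumNorm_rpow (hω : ∀ k i, 0 ≤ ω k i) (hs : s ≠ 0) (x : Fin n → ℝ) :
    sumNorm ω p s x ^ s = ∑ k, wNorm (ω k) (p k) x ^ s := by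
  rw [sumNorm, ← Real.rpow_mul (sumNorm_sum_nonneg hω p s x), one_div_mul_cancel hs,
    Real.rpow_one]

theorem exists_weight_pos (hsum : ∀ i, 0 < ∑ k, ω k i) (i : Fin n) :
    ∃ k, 0 < ω k i := by
  by_contra! h
  exact (hsum i).not_ge (Finset.sum_nonpos fun k _ => h k)

theorem sumNorm_pos (hω : ∀ k i, 0 ≤ ω k i) (hsum : ∀ i, 0 < ∑ k, ω k i)
    (hp : ∀ k, 1 < p k) (s : ℝ) {x : Fin n → ℝ} (hx : x ≠ 0) : 0 < sumNorm ω p s x := by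
  obtain ⟨i, hi⟩ := Function.ne_iff.mp hx
  obtain ⟨k, hk⟩ := exists_weight_pos hsum i
  refine Real.rpow_pos_of_pos (Finset.sum_pos' (fun k _ =>
    Real.rpow_nonneg (wNorm_nonneg (hω k) _ _) _) ⟨k, Finset.mem_univ k, ?_⟩) _
  exact Real.rpow_pos_of_pos (wNorm_pos (hω k) (by linarith [hp k]) hk hi) _

theorem isMonotoneNorm_sumNorm (hω : ∀ k i, 0 ≤ ω k i) (hsum : ∀ i, 0 < ∑ k, ω k i)
    (hp : ∀ k, 1 < p k) (hs : 1 ≤ s) : IsMonotoneNorm (sumNorm ω p s) := by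
  have hs0 : 0 < s := by linarith
  have hp0 : ∀ k, 0 < p k := fun k => by linarith [hp k]
  have hmono : ∀ a b : Fin d → ℝ, (∀ k, 0 ≤ a k) → (∀ k, a k ≤ b k) →
      (∑ k, a k ^ s) ^ (1 / s) ≤ (∑ k, b k ^ s) ^ (1 / s) := fun a b ha hab =>
    Real.rpow_le_rpow (Finset.sum_nonneg fun k _ => Real.rpow_nonneg (ha k) _)
      (Finset.sum_le_sum fun k _ => Real.rpow_le_rpow (ha k) (hab k) hs0.le) (by positivity)
  refine ⟨fun x y => ?_, fun c x => ?_, fun x hx => ?_, fun x y hxy => ?_⟩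
  · refine (hmono _ _ (fun k => wNorm_nonneg (hω k) _ _)
      fun k => wNorm_add_le (hω k) (hp k).le x y).trans ?_
    exact Real.Lp_add_le_of_nonneg Finset.univ hs (fun k _ => wNorm_nonneg (hω k) _ _)
      (fun k _ => wNorm_nonneg (hω k) _ _)
  · have h : ∑ k, wNorm (ω k) (p k) (c • x) ^ s = |c| ^ s * ∑ k, wNorm (ω k) (p k) x ^ s := by
      rw [Finset.mul_sum]
      refine Finset.sum_congr rfl fun k _ => ?_
      rw [wNorm_smul (hω k) (hp0 k).ne', Real.mul_rpow (abs_nonneg _) (wNorm_nonneg (hω k) _ _)]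
    rw [sumNorm, h, Real.mul_rpow (Real.rpow_nonneg (abs_nonneg _) _)
      (sumNorm_sum_nonneg hω p s x), ← Real.rpow_mul (abs_nonneg _), mul_one_div_cancel hs0.ne',
      Real.rpow_one, sumNorm]
  · by_contra h
    exact (sumNorm_pos hω hsum hp s h).ne' hx
  · exact hmono _ _ (fun k => wNorm_nonneg (hω k) _ _) fun k => wNorm_mono (hω k) (hp0 k) hxy

theorem hasDerivAt_wNorm_rpow {ω : Fin n → ℝ} {p : ℝ} (hω : ∀ i, 0 ≤ ω i) (hp : 1 < p) (s : ℝ)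
    {x : Fin n → ℝ} (hx : 0 < wNorm ω p x) (i : Fin n) :
    HasDerivAt (fun r : ℝ => wNorm ω p (x + r • Pi.single i 1) ^ s)
      (s * (wNorm ω p x ^ (s - p) * (ω i * (|x i| ^ (p - 2) * x i)))) 0 := by
  have hp0 : p ≠ 0 := by positivity
  have hS : HasDerivAt (fun r : ℝ => ∑ l, ω l * |(x + r • (Pi.single i 1 : Fin n → ℝ)) l| ^ p)
      (∑ l, ω l * (p * |x l| ^ (p - 2) * x l * (Pi.single i 1 : Fin n → ℝ) l)) 0 := by
    refine HasDerivAt.fun_sum fun l _ => HasDerivAt.const_mul _ ?_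
    have h1 : HasDerivAt (fun r : ℝ => (x + r • (Pi.single i 1 : Fin n → ℝ)) l)
        ((Pi.single i 1 : Fin n → ℝ) l) 0 := by
      have h : HasDerivAt (fun r : ℝ => x l + r * (Pi.single i 1 : Fin n → ℝ) l)
          (1 * (Pi.single i 1 : Fin n → ℝ) l) 0 :=
        ((hasDerivAt_id (0 : ℝ)).mul_const _).const_add _
      simpa using h
    have h2 := hasDerivAt_abs_rpow ((x + (0 : ℝ) • (Pi.single i 1 : Fin n → ℝ)) l) hp
    have h3 := h2.comp (0 : ℝ) h1
    simpa [Function.comp_def] using h3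
  have hsum : ∑ l, ω l * (p * |x l| ^ (p - 2) * x l * (Pi.single i 1 : Fin n → ℝ) l)
      = p * (ω i * (|x i| ^ (p - 2) * x i)) := by
    rw [Finset.sum_eq_single i]
    · simp; ring
    · intro l _ hl
      simp [hl]
    · simp
  rw [hsum] at hS
  have hS0 : ∑ l, ω l * |(x + (0 : ℝ) • (Pi.single i 1 : Fin n → ℝ)) l| ^ p
      = wNorm ω p x ^ p := by
    rw [wNorm_rpow hω hp0]
    simp
  have hpos : 0 < wNorm ω p x ^ p := Real.rpow_pos_of_pos hx p
  have h := hS.rpow_const (p := 1 / p * s) (Or.inl (by rw [hS0]; exact hpos.ne'))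
  rw [hS0] at h
  have hfun : (fun r : ℝ => wNorm ω p (x + r • Pi.single i 1) ^ s) = fun r : ℝ =>
      (∑ l, ω l * |(x + r • (Pi.single i 1 : Fin n → ℝ)) l| ^ p) ^ (1 / p * s) := by
    funext r
    rw [wNorm, ← Real.rpow_mul (wSum_nonneg hω p _)]
  rw [hfun]
  convert h using 1
  rw [← Real.rpow_mul hx.le, show p * (1 / p * s - 1) = s - p by field_simp]
  field_simp

theorem HasDerivAt.eq_zero_of_even {f : ℝ → ℝ} {a : ℝ} (h : HasDerivAt f a 0)
    (he : ∀ r, f (-r) = f r) : a = 0 := by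
  have h1 : HasDerivAt (fun r => f (-r)) (a * -1) 0 := by
    have h' : HasDerivAt f a (-0) := by rwa [neg_zero]
    exact h'.comp (0 : ℝ) (hasDerivAt_neg (0 : ℝ))
  simp only [he] at h1
  linarith [h.unique h1]

theorem normGradient_sumNorm (hω : ∀ k i, 0 ≤ ω k i) (hsum : ∀ i, 0 < ∑ k, ω k i)
    (hp : ∀ k, 1 < p k) (hs : 1 ≤ s) (hd : NormDifferentiable (sumNorm ω p s))
    (x : Fin n → ℝ) : normGradient (sumNorm ω p s) x = sumNormGrad ω p s x := by
  classical
  have hp0 : ∀ k, 0 < p k := fun k => by linarith [hp k]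
  have hs0 : s ≠ 0 := by positivity
  rcases eq_or_ne x 0 with rfl | hx
  · funext i
    simp [normGradient, sumNormGrad]
  funext i
  have hpos : 0 < sumNorm ω p s x := sumNorm_pos hω hsum hp s hx
  have hF := IsMonotoneNorm.hasDerivAt_line hd hx (Pi.single i 1)
  have hFs := hF.rpow_const (p := s) (Or.inl (by simpa using hpos.ne'))
  simp only [sumNorm_rpow hω hs0, zero_smul, add_zero, dotProduct_single, mul_one] at hFs
  set Z : Finset (Fin d) := Finset.univ.filter fun k => wNorm (ω k) (p k) x = 0 with hZ
  have hG : HasDerivAt (fun r : ℝ => ∑ k ∈ Zᶜ, wNorm (ω k) (p k) (x + r • Pi.single i 1) ^ s)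
      (∑ k ∈ Zᶜ, s * (wNorm (ω k) (p k) x ^ (s - p k) * (ω k i * (|x i| ^ (p k - 2) * x i)))) 0 := by
    refine HasDerivAt.fun_sum fun k hk => hasDerivAt_wNorm_rpow (hω k) (hp k) s ?_ i
    refine lt_of_le_of_ne (wNorm_nonneg (hω k) _ _) fun h => ?_
    simp [hZ, h.symm] at hk
  have hT := hFs.sub hG
  have hTe := HasDerivAt.eq_zero_of_even hT fun r => by
    have hdecomp : ∀ r : ℝ, (∑ k, wNorm (ω k) (p k) (x + r • Pi.single i 1) ^ s)
        - ∑ k ∈ Zᶜ, wNorm (ω k) (p k) (x + r • Pi.single i 1) ^ s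
        = ∑ k ∈ Z, wNorm (ω k) (p k) (x + r • Pi.single i 1) ^ s := fun r => by
      rw [← Finset.sum_add_sum_compl Z]
      ring
    simp only [Pi.sub_apply]
    rw [hdecomp, hdecomp]
    refine Finset.sum_congr rfl fun k hk => ?_
    have hk0 := (wNorm_eq_zero_iff (hω k) (hp0 k)).mp (Finset.mem_filter.mp hk).2
    rw [wNorm, wNorm]
    congr 2
    refine Finset.sum_congr rfl fun l _ => ?_
    rcases hk0 l with h | h
    · simp [h]
    · simp [h]
  have hZsum : ∑ k ∈ Zᶜ, s * (wNorm (ω k) (p k) x ^ (s - p k) *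
      (ω k i * (|x i| ^ (p k - 2) * x i))) =
      s * ∑ k, wNorm (ω k) (p k) x ^ (s - p k) * (ω k i * (|x i| ^ (p k - 2) * x i)) := by
    rw [Finset.mul_sum, ← Finset.sum_add_sum_compl Z, right_eq_add]
    refine Finset.sum_eq_zero fun k hk => ?_
    rcases (wNorm_eq_zero_iff (hω k) (hp0 k)).mp (Finset.mem_filter.mp hk).2 i with h | h <;>
      simp [h]
  rw [hZsum] at hTe
  rw [sumNormGrad, show (1 - s) = -(s - 1) by ring, Real.rpow_neg hpos.le]
  have h1 : 0 < sumNorm ω p s x ^ (s - 1) := Real.rpow_pos_of_pos hpos _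
  rw [eq_inv_mul_iff_mul_eq₀ h1.ne']
  refine mul_left_cancel₀ hs0 ?_
  linarith

end SumNorm

section DualWeight

variable {n : ℕ} {ω : Fin n → ℝ} {p : ℝ}

theorem dualWeight_nonneg (hω : ∀ i, 0 ≤ ω i) (p : ℝ) (i : Fin n) : 0 ≤ dualWeight ω p i := by
  unfold dualWeight
  split_ifs
  exacts [Real.rpow_nonneg (hω i) _, le_rfl]

theorem dualWeight_eq_zero_iff (hω : ∀ i, 0 ≤ ω i) {i : Fin n} :
    dualWeight ω p i = 0 ↔ ω i = 0 := by
  unfold dualWeight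
  split_ifs with h
  · exact ⟨fun h' => absurd h' (Real.rpow_pos_of_pos h _).ne', fun h' => absurd h' h.ne'⟩
  · exact ⟨fun _ => le_antisymm (not_lt.mp h) (hω i), fun _ => rfl⟩

/-- Hölder's inequality for weighted `ℓ^p` norms. -/
theorem dotProduct_le_wNorm_mul_wNorm (hω : ∀ i, 0 ≤ ω i) (hp : 1 < p) {u : Fin n → ℝ}
    (hu : ∀ i, ω i = 0 → u i = 0) (y : Fin n → ℝ) :
    u ⬝ᵥ y ≤ wNorm (dualWeight ω p) p.conjExponent u * wNorm ω p y := by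
  have hpq := Real.HolderConjugate.conjExponent hp
  set q := p.conjExponent with hq
  have h := Real.inner_le_Lp_mul_Lq Finset.univ (fun i => ω i ^ (-(1 / p)) * u i)
    (fun i => ω i ^ (1 / p) * y i) hpq.symm
  have h1 : ∑ i, ω i ^ (-(1 / p)) * u i * (ω i ^ (1 / p) * y i) = u ⬝ᵥ y := by
    refine Finset.sum_congr rfl fun i _ => ?_
    rcases (hω i).eq_or_lt with h0 | h0
    · simp [hu i h0.symm]
    · rw [Real.rpow_neg h0.le]
      have := (Real.rpow_pos_of_pos h0 (1 / p)).ne'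
      field_simp
  have h2 : ∑ i, |ω i ^ (-(1 / p)) * u i| ^ q = ∑ i, dualWeight ω p i * |u i| ^ q := by
    refine Finset.sum_congr rfl fun i _ => ?_
    rcases (hω i).eq_or_lt with h0 | h0
    · simp [hu i h0.symm, hpq.symm.ne_zero]
    · rw [abs_mul, abs_of_nonneg (Real.rpow_nonneg h0.le _),
        Real.mul_rpow (Real.rpow_nonneg h0.le _) (abs_nonneg _), ← Real.rpow_mul h0.le,
        dualWeight, if_pos h0]
      congr 2
      have h4 : p - 1 ≠ 0 := by linarith
      rw [← hq, hq, Real.conjExponent]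
      field_simp
      ring
  have h3 : ∑ i, |ω i ^ (1 / p) * y i| ^ p = ∑ i, ω i * |y i| ^ p := by
    refine Finset.sum_congr rfl fun i _ => ?_
    rw [abs_mul, abs_of_nonneg (Real.rpow_nonneg (hω i) _),
      Real.mul_rpow (Real.rpow_nonneg (hω i) _) (abs_nonneg _), ← Real.rpow_mul (hω i),
      one_div_mul_cancel hpq.ne_zero, Real.rpow_one]
  rw [h1, h2, h3] at h
  exact h

theorem wNorm_dualWeight_duality (hω : ∀ i, 0 ≤ ω i) (hp : 1 < p) (y : Fin n → ℝ) :
    wNorm (dualWeight ω p) p.conjExponent (fun i => ω i * (|y i| ^ (p - 2) * y i)) =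
      wNorm ω p y ^ (p - 1) := by
  have hpq := Real.HolderConjugate.conjExponent hp
  have hp1 : p - 1 ≠ 0 := by linarith
  have h : ∑ i, dualWeight ω p i * |ω i * (|y i| ^ (p - 2) * y i)| ^ p.conjExponent
      = wNorm ω p y ^ p := by
    rw [wNorm_rpow hω hpq.ne_zero]
    refine Finset.sum_congr rfl fun i _ => ?_
    rcases (hω i).eq_or_lt with h0 | h0
    · simp [← h0, hpq.symm.ne_zero]
    rcases eq_or_ne (y i) 0 with hy | hy
    · simp [hy, hpq.symm.ne_zero, hpq.ne_zero]
    have hy' : 0 < |y i| := abs_pos.mpr hy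
    have h1 : |ω i * (|y i| ^ (p - 2) * y i)| = ω i * |y i| ^ (p - 1) := by
      rw [abs_mul, abs_mul, abs_of_pos h0, abs_of_nonneg (Real.rpow_nonneg hy'.le _),
        ← Real.rpow_add_one hy'.ne']
      congr 2
      ring
    rw [h1, Real.mul_rpow h0.le (Real.rpow_nonneg hy'.le _), ← Real.rpow_mul hy'.le,
      hpq.sub_one_mul_conj, dualWeight, if_pos h0, ← mul_assoc, ← Real.rpow_add h0]
    simp
  rw [wNorm, h, ← Real.rpow_mul (wNorm_nonneg hω _ _)]
  congr 1
  rw [Real.conjExponent]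
  have := hpq.ne_zero
  field_simp

end DualWeight

/-- The dual of a sum of weighted norms is an infimal convolution of the dual norms. -/
theorem isLeast_splitValues {n h : ℕ} {ϖ : Fin h → Fin n → ℝ} {q : Fin h → ℝ} {t : ℝ}
    (hn : 0 < n) (hϖ : ∀ k i, 0 ≤ ϖ k i) (hsum : ∀ i, 0 < ∑ k, ϖ k i)
    (hq : ∀ k, 1 < q k) (ht : 1 < t) (hd : NormDifferentiable (sumNorm ϖ q t))
    (x : Fin n → ℝ) :
    IsLeast (splitValues (fun k => dualWeight (ϖ k) (q k)) (fun k => (q k).conjExponent)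
      t.conjExponent x) (dualNorm (sumNorm ϖ q t) x) := by
  have hN := isMonotoneNorm_sumNorm hϖ hsum hq ht.le
  have htt := Real.HolderConjugate.conjExponent ht
  obtain ⟨y, hy, hxy, hle⟩ := hN.exists_dualNorm_eq hn x
  have hD := hN.dualNorm hn
  set b := dualNorm (sumNorm ϖ q t) x with hb
  have hb0 : 0 ≤ b := hD.nonneg x
  have hdw : ∀ k i, 0 ≤ dualWeight (ϖ k) (q k) i := fun k => dualWeight_nonneg (hϖ k) _
  have hWsum : ∑ k, wNorm (ϖ k) (q k) y ^ t = 1 := by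
    rw [← sumNorm_rpow hϖ htt.ne_zero, hy, Real.one_rpow]
  constructor
  · have hxg : x = b • sumNormGrad ϖ q t y := by
      rcases eq_or_ne x 0 with rfl | hx
      · rw [hb, hD.map_zero, zero_smul]
      have hbpos : 0 < b := hD.pos hx
      have hy0 : y ≠ 0 := by
        rintro rfl
        rw [hN.map_zero] at hy
        exact zero_ne_one hy
      have := IsMonotoneNorm.eq_normGradient (y := b⁻¹ • x) hd hy0
        (by rw [smul_dotProduct, hxy, hy, smul_eq_mul, inv_mul_cancel₀ hbpos.ne'])
        (fun z => by
          rw [smul_dotProduct, smul_eq_mul, inv_mul_le_iff₀ hbpos]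
          exact hle z)
      rw [← normGradient_sumNorm hϖ hsum hq ht.le hd, ← this, smul_smul,
        mul_inv_cancel₀ hbpos.ne', one_smul]
    refine ⟨fun k => (b * wNorm (ϖ k) (q k) y ^ (t - q k)) •
      fun i => ϖ k i * (|y i| ^ (q k - 2) * y i), ?_, ?_, ?_⟩
    · conv_rhs => rw [hxg]
      funext i
      simp only [Finset.sum_apply, Pi.smul_apply, smul_eq_mul, sumNormGrad, hy, Real.one_rpow,
        one_mul, Finset.mul_sum, mul_assoc]
    · intro k i hk
      simp [(dualWeight_eq_zero_iff (hϖ k)).mp hk]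
    · have hterm : ∀ k, wNorm (dualWeight (ϖ k) (q k)) (q k).conjExponent
          ((b * wNorm (ϖ k) (q k) y ^ (t - q k)) • fun i => ϖ k i * (|y i| ^ (q k - 2) * y i))
          ^ t.conjExponent = b ^ t.conjExponent * wNorm (ϖ k) (q k) y ^ t := fun k => by
        have hW := wNorm_nonneg (hϖ k) (q k) y
        rw [wNorm_smul (hdw k) (Real.HolderConjugate.conjExponent (hq k)).symm.ne_zero,
          wNorm_dualWeight_duality (hϖ k) (hq k), abs_of_nonneg
          (mul_nonneg hb0 (Real.rpow_nonneg hW _)), mul_assoc]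
        have : wNorm (ϖ k) (q k) y ^ (t - q k) * wNorm (ϖ k) (q k) y ^ (q k - 1) =
            wNorm (ϖ k) (q k) y ^ (t - 1) := by
          rcases hW.eq_or_lt with h0 | h0
          · rw [← h0, Real.zero_rpow (by linarith [hq k] : q k - 1 ≠ 0),
              Real.zero_rpow (by linarith : t - 1 ≠ 0), mul_zero]
          · rw [← Real.rpow_add h0]
            congr 1
            ring
        rw [this, Real.mul_rpow hb0 (Real.rpow_nonneg hW _), ← Real.rpow_mul hW,
          htt.sub_one_mul_conj]
      simp only [hterm]
      rw [← Finset.mul_sum, hWsum, mul_one, ← Real.rpow_mul hb0,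
        mul_one_div_cancel htt.symm.ne_zero, Real.rpow_one]
  · rintro a ⟨u, rfl, hsupp, rfl⟩
    rw [← hxy, sum_dotProduct]
    have h1 : ∑ k, u k ⬝ᵥ y ≤ ∑ k, wNorm (dualWeight (ϖ k) (q k)) (q k).conjExponent (u k) *
        wNorm (ϖ k) (q k) y := Finset.sum_le_sum fun k _ =>
      dotProduct_le_wNorm_mul_wNorm (hϖ k) (hq k)
        (fun i hi => hsupp k i ((dualWeight_eq_zero_iff (hϖ k)).mpr hi)) y
    have h2 := Real.inner_le_Lp_mul_Lq_of_nonneg Finset.univ htt.symm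
      (fun k _ => wNorm_nonneg (hdw k) (q k).conjExponent (u k))
      (fun k _ => wNorm_nonneg (hϖ k) (q k) y)
    rw [hWsum, Real.one_rpow, mul_one] at h2
    exact h1.trans h2

/-- `x ≤ C y` and `y ≤ D x` with `C D ≤ exp r`: a real form of `hilbertDist x y ≤ r`. -/
def OrderClose {n : ℕ} (r : ℝ) (x y : Fin n → ℝ) : Prop :=
  ∃ C D : ℝ, 0 < C ∧ 0 < D ∧ x ≤ C • y ∧ y ≤ D • x ∧ C * D ≤ Real.exp r

section Hilbert

variable {n m : ℕ} {x y : Fin n → ℝ} {r : ℝ}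

theorem OrderClose.comparable (h : OrderClose r x y) : Comparable x y := by
  obtain ⟨C, D, hC, hD, hxy, hyx, _⟩ := h
  refine ⟨D⁻¹, C, inv_pos.mpr hD, hC, fun i => ?_, hxy⟩
  simpa [inv_mul_le_iff₀ hD] using hyx i

theorem exists_pos_of_nonneg_of_ne_zero (hx : 0 ≤ x) (hx0 : x ≠ 0) : ∃ i, 0 < x i := by
  obtain ⟨i, hi⟩ := Function.ne_iff.mp hx0
  exact ⟨i, lt_of_le_of_ne (hx i) (Ne.symm hi)⟩

theorem coneM_nonneg (x y : Fin n → ℝ) : 0 ≤ coneM x y :=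
  Real.sInf_nonneg fun _ h => h.1.le

theorem coneM_le {C : ℝ} (hC : 0 < C) (h : x ≤ C • y) : coneM x y ≤ C :=
  csInf_le ⟨0, fun _ h => h.1.le⟩ ⟨hC, h⟩

theorem div_le_coneM {C : ℝ} (hC : 0 < C) (h : x ≤ C • y) {i : Fin n} (hy : 0 < y i) :
    x i / y i ≤ coneM x y :=
  le_csInf ⟨C, hC, h⟩ fun _ hB => (div_le_iff₀ hy).mpr (hB.2 i)

theorem le_coneM_smul {C : ℝ} (hC : 0 < C) (hy : 0 ≤ y) (h : x ≤ C • y) :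
    x ≤ coneM x y • y := fun i => by
  rcases (hy i).eq_or_lt with h0 | h0
  · have := h i
    simp only [Pi.smul_apply, ← h0, Pi.zero_apply, smul_zero] at this ⊢
    exact this
  · exact (div_le_iff₀ h0).mp (div_le_coneM hC h h0)

theorem coneM_pos {C : ℝ} (hC : 0 < C) (hx : 0 ≤ x) (hx0 : x ≠ 0) (h : x ≤ C • y) :
    0 < coneM x y := by
  obtain ⟨i, hi⟩ := exists_pos_of_nonneg_of_ne_zero hx hx0
  have hy : 0 < y i := (mul_pos_iff_of_pos_left hC).mp (hi.trans_le (h i))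
  exact (div_pos hi hy).trans_le (div_le_coneM hC h hy)

theorem OrderClose.hilbertDist_le (h : OrderClose r x y) (hx : 0 ≤ x) (hx0 : x ≠ 0) :
    hilbertDist x y ≤ ENNReal.ofReal r := by
  have hcomp := h.comparable
  obtain ⟨C, D, hC, hD, hxy, hyx, hCD⟩ := h
  rw [hilbertDist, if_neg (fun h => hx0 h.1), if_pos hcomp]
  apply ENNReal.ofReal_le_ofReal
  have hy0 : y ≠ 0 := by
    rintro rfl
    refine hx0 (le_antisymm (by simpa using hxy) hx)
  have hy : 0 ≤ y := fun i => nonneg_of_mul_nonneg_right ((hx i).trans (hxy i)) hC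
  rw [← Real.log_exp r]
  refine Real.log_le_log (mul_pos (coneM_pos hC hx hx0 hxy) (coneM_pos hD hy hy0 hyx))
    (le_trans ?_ hCD)
  exact mul_le_mul (coneM_le hC hxy) (coneM_le hD hyx) (coneM_nonneg _ _) hC.le

theorem orderClose_of_hilbertDist_le (h : hilbertDist x y ≤ ENNReal.ofReal r) (hr : 0 ≤ r)
    (hx : 0 ≤ x) (hy : 0 ≤ y) (hx0 : x ≠ 0) : OrderClose r x y := by
  rw [hilbertDist, if_neg (fun h => hx0 h.1)] at h
  split_ifs at h with hcomp
  · obtain ⟨c, C, hc, hC, hcy, hxC⟩ := hcomp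
    have hyx : y ≤ c⁻¹ • x := fun i => by
      have := hcy i
      simp only [Pi.smul_apply, smul_eq_mul] at this ⊢
      rwa [le_inv_mul_iff₀ hc]
    have hc' := inv_pos.mpr hc
    have hy0 : y ≠ 0 := by
      rintro rfl
      exact hx0 (le_antisymm (by simpa using hxC) hx)
    have h1 := coneM_pos hC hx hx0 hxC
    have h2 := coneM_pos hc' hy hy0 hyx
    refine ⟨coneM x y, coneM y x, h1, h2, le_coneM_smul hC hy hxC, le_coneM_smul hc' hx hyx, ?_⟩
    rw [ENNReal.ofReal_le_ofReal_iff hr] at h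
    rwa [← Real.log_le_iff_le_exp (mul_pos h1 h2)]
  · simp at h

theorem mulVec_le_mulVec {A : Matrix (Fin m) (Fin n) ℝ} (hA : ∀ i j, 0 ≤ A i j) (h : x ≤ y) :
    A *ᵥ x ≤ A *ᵥ y := fun i => by
  simp only [Matrix.mulVec, dotProduct]
  exact Finset.sum_le_sum fun j _ => mul_le_mul_of_nonneg_left (h j) (hA i j)

theorem mulVec_nonneg {A : Matrix (Fin m) (Fin n) ℝ} (hA : ∀ i j, 0 ≤ A i j) (h : 0 ≤ x) :
    0 ≤ A *ᵥ x := by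
  simpa using mulVec_le_mulVec hA h

theorem OrderClose.mulVec {A : Matrix (Fin m) (Fin n) ℝ} (hA : ∀ i j, 0 ≤ A i j)
    (h : OrderClose r x y) : OrderClose r (A *ᵥ x) (A *ᵥ y) := by
  obtain ⟨C, D, hC, hD, hxy, hyx, hCD⟩ := h
  refine ⟨C, D, hC, hD, ?_, ?_, hCD⟩
  · rw [← Matrix.mulVec_smul]
    exact mulVec_le_mulVec hA hxy
  · rw [← Matrix.mulVec_smul]
    exact mulVec_le_mulVec hA hyx

theorem OrderClose.eq_zero (h : OrderClose r x y) (hx : 0 ≤ x) (hy : 0 ≤ y) :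
    x = 0 ↔ y = 0 := by
  obtain ⟨C, D, hC, hD, hxy, hyx, hCD⟩ := h
  constructor
  · rintro rfl
    exact le_antisymm (by simpa using hyx) hy
  · rintro rfl
    exact le_antisymm (by simpa using hxy) hx

theorem birkhoffRatio_mulVec_le_one {A : Matrix (Fin m) (Fin n) ℝ} (hA : ∀ i j, 0 ≤ A i j) :
    birkhoffRatio (fun x : Fin n → ℝ => A *ᵥ x) ≤ 1 := by
  refine sInf_le ⟨one_pos, ENNReal.one_lt_top, fun x y hx hy hxy => ?_⟩
  rw [one_mul]
  rcases eq_or_ne (hilbertDist x y) ⊤ with htop | htop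
  · rw [htop]; exact le_top
  have hr := ENNReal.ofReal_toReal htop
  have key : x ≠ 0 → OrderClose (hilbertDist x y).toReal x y :=
    orderClose_of_hilbertDist_le hr.ge ENNReal.toReal_nonneg hx hy
  rcases eq_or_ne (A *ᵥ x) 0 with h0 | h0
  · have h1 : A *ᵥ y = 0 := by
      rcases eq_or_ne x 0 with rfl | hx0
      · obtain ⟨c, _, hc, _, h, _⟩ := hxy
        have : y = 0 := le_antisymm (fun i => by
          have := h i
          simp only [Pi.smul_apply, smul_eq_mul, Pi.zero_apply] at this ⊢
          exact nonpos_of_mul_nonpos_right this hc) hy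
        rw [this, Matrix.mulVec_zero]
      · exact (((key hx0).mulVec hA).eq_zero (mulVec_nonneg hA hx) (mulVec_nonneg hA hy)).mp h0
    simp [hilbertDist, h0, h1]
  · have hx0 : x ≠ 0 := by
      rintro rfl
      exact h0 (Matrix.mulVec_zero A)
    have h2 := ((key hx0).mulVec hA).hilbertDist_le (mulVec_nonneg hA hx) h0
    rwa [hr] at h2

theorem OrderClose.mulVec_of_birkhoffRatio_lt {A : Matrix (Fin m) (Fin n) ℝ}
    (hA : ∀ i j, 0 ≤ A i j) {c : ℝ}
    (hc : birkhoffRatio (fun x : Fin n → ℝ => A *ᵥ x) < ENNReal.ofReal c)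
    (h : OrderClose r x y) (hr : 0 ≤ r) (hx : 0 ≤ x) (hy : 0 ≤ y) (hAx : A *ᵥ x ≠ 0) :
    OrderClose (c * r) (A *ᵥ x) (A *ᵥ y) := by
  obtain ⟨C, ⟨_, _, hC⟩, hCc⟩ := sInf_lt_iff.mp hc
  have hc0 : 0 ≤ c := (ENNReal.ofReal_pos.mp ((zero_le).trans_lt hCc)).le
  have hx0 : x ≠ 0 := by
    rintro rfl
    exact hAx (Matrix.mulVec_zero A)
  refine orderClose_of_hilbertDist_le ?_ (mul_nonneg hc0 hr) (mulVec_nonneg hA hx)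
    (mulVec_nonneg hA hy) hAx
  rw [ENNReal.ofReal_mul hc0]
  exact (hC x y hx hy h.comparable).trans (mul_le_mul' hCc.le (h.hilbertDist_le hx hx0))

end Hilbert

section TauBound

variable {m n d h : ℕ}

theorem expoFactor_nonneg (p : Fin d → ℝ) {s : ℝ} (hs : 1 ≤ s) : 0 ≤ expoFactor p s :=
  add_nonneg (by linarith) (Finset.sum_nonneg fun k _ => le_max_left _ _)

theorem exists_contraction_constants {A : Matrix (Fin m) (Fin n) ℝ} (hA : ∀ i j, 0 ≤ A i j)
    {p : Fin d → ℝ} {s : ℝ} {q : Fin h → ℝ} {t : ℝ} (hs : 1 ≤ s)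
    (hτ : tauBound A p s q t < 1) :
    ∃ a b : ℝ, 0 < a ∧ 0 < b ∧ a * b * expoFactor p s * expoFactor q t < 1 ∧
      birkhoffRatio (fun x : Fin n → ℝ => A *ᵥ x) < ENNReal.ofReal a ∧
      birkhoffRatio (fun x : Fin m → ℝ => Aᵀ *ᵥ x) < ENNReal.ofReal b := by
  unfold tauBound at hτ
  have h1 : birkhoffRatio (fun x : Fin n → ℝ => A *ᵥ x) ≠ ⊤ :=
    ((birkhoffRatio_mulVec_le_one hA).trans_lt ENNReal.one_lt_top).ne
  have h2 : birkhoffRatio (fun x : Fin m → ℝ => Aᵀ *ᵥ x) ≠ ⊤ :=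
    ((birkhoffRatio_mulVec_le_one (A := Aᵀ) fun i j => hA j i).trans_lt ENNReal.one_lt_top).ne
  rw [← ENNReal.ofReal_toReal h1, ← ENNReal.ofReal_toReal h2] at hτ ⊢
  set a := (birkhoffRatio (fun x : Fin n → ℝ => A *ᵥ x)).toReal with ha
  set b := (birkhoffRatio (fun x : Fin m → ℝ => Aᵀ *ᵥ x)).toReal with hb
  have ha0 : 0 ≤ a := ENNReal.toReal_nonneg
  have hb0 : 0 ≤ b := ENNReal.toReal_nonneg
  rw [← ENNReal.ofReal_mul ha0, ← ENNReal.ofReal_mul (by positivity),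
    ← ENNReal.ofReal_mul (mul_nonneg (by positivity) (expoFactor_nonneg p hs)),
    ENNReal.ofReal_lt_one] at hτ
  have hcont : Filter.Tendsto (fun δ : ℝ => (a + δ) * (b + δ) * expoFactor p s * expoFactor q t)
      (nhdsWithin 0 (Set.Ioi 0)) (nhds (a * b * expoFactor p s * expoFactor q t)) := by
    have : Continuous fun δ : ℝ => (a + δ) * (b + δ) * expoFactor p s * expoFactor q t := by
      fun_prop
    simpa using (this.tendsto 0).mono_left nhdsWithin_le_nhds
  obtain ⟨δ, hδ, hδ0⟩ := ((hcont.eventually_lt_const hτ).and self_mem_nhdsWithin).exists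
  have hδ0 : 0 < δ := hδ0
  exact ⟨a + δ, b + δ, by positivity, by positivity, hδ,
    (ENNReal.ofReal_lt_ofReal_iff (by positivity)).mpr (by linarith),
    (ENNReal.ofReal_lt_ofReal_iff (by positivity)).mpr (by linarith)⟩

end TauBound

section GradContraction

variable {n d : ℕ} {ω : Fin d → Fin n → ℝ} {p : Fin d → ℝ} {s : ℝ}

theorem abs_rpow_mul_self_of_nonneg {a p : ℝ} (ha : 0 ≤ a) (hp : 1 < p) :
    |a| ^ (p - 2) * a = a ^ (p - 1) := by
  rw [abs_of_nonneg ha]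
  rcases ha.eq_or_lt with h | h
  · rw [← h, Real.zero_rpow (by linarith : p - 1 ≠ 0), mul_zero]
  · rw [← Real.rpow_add_one h.ne']
    congr 1
    ring

theorem sumNormGrad_nonneg (hω : ∀ k i, 0 ≤ ω k i) {x : Fin n → ℝ} (hx : 0 ≤ x) :
    0 ≤ sumNormGrad ω p s x := fun i =>
  mul_nonneg (Real.rpow_nonneg (sumNorm_nonneg hω p s x) _) <| Finset.sum_nonneg fun k _ =>
    mul_nonneg (Real.rpow_nonneg (wNorm_nonneg (hω k) _ _) _) <| mul_nonneg (hω k i) <|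
      mul_nonneg (Real.rpow_nonneg (abs_nonneg _) _) (hx i)

theorem sumNormGrad_pos (hω : ∀ k i, 0 ≤ ω k i) (hsum : ∀ i, 0 < ∑ k, ω k i)
    (hp : ∀ k, 1 < p k) {x : Fin n → ℝ} (hx : 0 ≤ x) {i : Fin n} (hi : 0 < x i) :
    0 < sumNormGrad ω p s x i := by
  have hx0 : x ≠ 0 := fun h => hi.ne' (congrFun h i)
  obtain ⟨k, hk⟩ := exists_weight_pos hsum i
  refine mul_pos (Real.rpow_pos_of_pos (sumNorm_pos hω hsum hp s hx0) _) <|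
    Finset.sum_pos' (fun k _ => mul_nonneg (Real.rpow_nonneg (wNorm_nonneg (hω k) _ _) _) <|
      mul_nonneg (hω k i) <| mul_nonneg (Real.rpow_nonneg (abs_nonneg _) _) (hx i))
      ⟨k, Finset.mem_univ k, ?_⟩
  exact mul_pos (Real.rpow_pos_of_pos (wNorm_pos (hω k) (by linarith [hp k]) hk hi.ne') _)
    (mul_pos hk (mul_pos (Real.rpow_pos_of_pos (abs_pos.mpr hi.ne') _) hi))

theorem wNorm_le_of_le_smul {ω : Fin n → ℝ} {p : ℝ} (hω : ∀ i, 0 ≤ ω i) (hp : 0 < p)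
    {x y : Fin n → ℝ} {C : ℝ} (hx : 0 ≤ x) (hC : 0 ≤ C) (h : x ≤ C • y) :
    wNorm ω p x ≤ C * wNorm ω p y := by
  rw [← abs_of_nonneg hC, ← wNorm_smul hω hp.ne']
  exact wNorm_mono hω hp fun i => by
    rw [abs_of_nonneg (hx i)]
    exact (h i).trans (le_abs_self _)

/-- After multiplication by a suitable product of powers of the seminorms, the gradient formula
becomes monotone and homogeneous of degree at most `expoFactor p s`. -/
theorem prod_mul_sumNormGrad_le (hω : ∀ k i, 0 ≤ ω k i) (hsum : ∀ i, 0 < ∑ k, ω k i)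
    (hp : ∀ k, 1 < p k) {x y : Fin n → ℝ} {C : ℝ} (hC : 0 < C) (hx : 0 ≤ x) (hy : 0 ≤ y)
    (hx0 : x ≠ 0) (hy0 : y ≠ 0) (h : x ≤ C • y) {K : Finset (Fin d)}
    (hKx : ∀ k, k ∈ K ↔ wNorm (ω k) (p k) x ≠ 0)
    (hKy : ∀ k, k ∈ K ↔ wNorm (ω k) (p k) y ≠ 0) (i : Fin n) :
    (∏ k ∈ K, wNorm (ω k) (p k) x ^ max 0 (p k - s)) * sumNorm ω p s x ^ (s - 1) *
        sumNormGrad ω p s x i ≤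
      C ^ (s - 1 + ∑ k ∈ K, max 0 (p k - s)) *
        ((∏ k ∈ K, wNorm (ω k) (p k) y ^ max 0 (p k - s)) * sumNorm ω p s y ^ (s - 1) *
          sumNormGrad ω p s y i) := by
  classical
  have hp0 : ∀ k, 0 < p k := fun k => by linarith [hp k]
  have hcancel : ∀ z : Fin n → ℝ, 0 ≤ z → z ≠ 0 → (∀ k, k ∈ K ↔ wNorm (ω k) (p k) z ≠ 0) →
      (∏ k ∈ K, wNorm (ω k) (p k) z ^ max 0 (p k - s)) * sumNorm ω p s z ^ (s - 1) *
        sumNormGrad ω p s z i = ∑ k ∈ K,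
        (∏ j ∈ K.erase k, wNorm (ω j) (p j) z ^ max 0 (p j - s)) *
          (wNorm (ω k) (p k) z ^ max 0 (s - p k) * (ω k i * z i ^ (p k - 1))) := by
    intro z hz hz0 hK
    have hpos := sumNorm_pos hω hsum hp s hz0
    have h1 : sumNorm ω p s z ^ (s - 1) * sumNorm ω p s z ^ (1 - s) = 1 := by
      rw [← Real.rpow_add hpos]
      simp
    rw [sumNormGrad, mul_assoc, ← mul_assoc (sumNorm ω p s z ^ (s - 1)), h1, one_mul,
      Finset.mul_sum, ← Finset.sum_subset (Finset.subset_univ K)]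
    · refine Finset.sum_congr rfl fun k hk => ?_
      have hW : 0 < wNorm (ω k) (p k) z :=
        lt_of_le_of_ne (wNorm_nonneg (hω k) _ _) ((hK k).mp hk).symm
      rw [← Finset.prod_erase_mul K _ hk, mul_assoc, ← mul_assoc (_ ^ max 0 (p k - s)),
        ← Real.rpow_add hW, abs_rpow_mul_self_of_nonneg (hz i) (hp k)]
      congr 3
      rcases le_total (p k) s with h | h
      · rw [max_eq_left (by linarith), max_eq_right (by linarith)]; ring
      · rw [max_eq_right (by linarith), max_eq_left (by linarith)]; ring
    · intro k _ hk
      have h0 : wNorm (ω k) (p k) z = 0 := by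
        by_contra h
        exact hk ((hK k).mpr h)
      rcases (wNorm_eq_zero_iff (hω k) (hp0 k)).mp h0 i with h | h <;> simp [h]
  rw [hcancel x hx hx0 hKx, hcancel y hy hy0 hKy, Finset.mul_sum]
  refine Finset.sum_le_sum fun k hk => ?_
  have hWle : ∀ j, ∀ a : ℝ, 0 ≤ a → wNorm (ω j) (p j) x ^ a ≤ C ^ a * wNorm (ω j) (p j) y ^ a :=
    fun j a ha => by
      rw [← Real.mul_rpow hC.le (wNorm_nonneg (hω j) _ _)]
      exact Real.rpow_le_rpow (wNorm_nonneg (hω j) _ _)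
        (wNorm_le_of_le_smul (hω j) (hp0 j) hx hC.le h) ha
  have hexp : C ^ (s - 1 + ∑ k ∈ K, max 0 (p k - s)) =
      (∏ j ∈ K.erase k, C ^ max 0 (p j - s)) * (C ^ max 0 (s - p k) * C ^ (p k - 1)) := by
    rw [← Real.rpow_sum_of_pos hC, ← Real.rpow_add hC, ← Real.rpow_add hC,
      ← Finset.sum_erase_add K _ hk]
    congr 1
    rcases le_total (p k) s with h | h
    · rw [max_eq_left (by linarith : p k - s ≤ 0), max_eq_right (by linarith : 0 ≤ s - p k)]; ring
    · rw [max_eq_right (by linarith : 0 ≤ p k - s), max_eq_left (by linarith : s - p k ≤ 0)]; ring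
  have hprod : ∏ j ∈ K.erase k, wNorm (ω j) (p j) x ^ max 0 (p j - s) ≤
      (∏ j ∈ K.erase k, C ^ max 0 (p j - s)) *
        ∏ j ∈ K.erase k, wNorm (ω j) (p j) y ^ max 0 (p j - s) := by
    rw [← Finset.prod_mul_distrib]
    exact Finset.prod_le_prod (fun j _ => Real.rpow_nonneg (wNorm_nonneg (hω j) _ _) _)
      fun j _ => hWle j _ (le_max_left _ _)
  have hxi : x i ^ (p k - 1) ≤ C ^ (p k - 1) * y i ^ (p k - 1) := by
    rw [← Real.mul_rpow hC.le (hy i)]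
    exact Real.rpow_le_rpow (hx i) (h i) (by linarith [hp k])
  have hyi : 0 ≤ y i ^ (p k - 1) := Real.rpow_nonneg (hy i) _
  have hxi' : 0 ≤ x i ^ (p k - 1) := Real.rpow_nonneg (hx i) _
  have hWx := Real.rpow_nonneg (wNorm_nonneg (hω k) (p k) x) (max 0 (s - p k))
  have hWy := Real.rpow_nonneg (wNorm_nonneg (hω k) (p k) y) (max 0 (s - p k))
  have hPy : 0 ≤ ∏ j ∈ K.erase k, wNorm (ω j) (p j) y ^ max 0 (p j - s) :=
    Finset.prod_nonneg fun j _ => Real.rpow_nonneg (wNorm_nonneg (hω j) _ _) _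
  have hPC : 0 ≤ ∏ j ∈ K.erase k, C ^ max 0 (p j - s) :=
    Finset.prod_nonneg fun j _ => Real.rpow_nonneg hC.le _
  have hC1 : 0 ≤ C ^ max 0 (s - p k) := Real.rpow_nonneg hC.le _
  rw [hexp]
  calc _ ≤ ((∏ j ∈ K.erase k, C ^ max 0 (p j - s)) *
        ∏ j ∈ K.erase k, wNorm (ω j) (p j) y ^ max 0 (p j - s)) *
        ((C ^ max 0 (s - p k) * wNorm (ω k) (p k) y ^ max 0 (s - p k)) *
          (ω k i * (C ^ (p k - 1) * y i ^ (p k - 1)))) := by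
        refine mul_le_mul hprod (mul_le_mul (hWle k _ (le_max_left _ _))
          (mul_le_mul_of_nonneg_left hxi (hω k i)) (mul_nonneg (hω k i) hxi') (by positivity))
          (mul_nonneg hWx (mul_nonneg (hω k i) hxi')) (by positivity)
    _ = _ := by ring

theorem OrderClose.sumNormGrad (hω : ∀ k i, 0 ≤ ω k i) (hsum : ∀ i, 0 < ∑ k, ω k i)
    (hp : ∀ k, 1 < p k) (hs : 1 ≤ s) {x y : Fin n → ℝ} {r : ℝ} (hr : 0 ≤ r) (hx : 0 ≤ x)
    (hy : 0 ≤ y) (hx0 : x ≠ 0) (h : OrderClose r x y) :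
    OrderClose (expoFactor p s * r) (sumNormGrad ω p s x) (sumNormGrad ω p s y) := by
  classical
  have hp0 : ∀ k, 0 < p k := fun k => by linarith [hp k]
  have hy0 : y ≠ 0 := fun h' => hx0 ((h.eq_zero hx hy).mpr h')
  obtain ⟨C, D, hC, hD, hxy, hyx, hCD⟩ := h
  set K : Finset (Fin d) := Finset.univ.filter fun k => wNorm (ω k) (p k) x ≠ 0 with hK
  have hKx : ∀ k, k ∈ K ↔ wNorm (ω k) (p k) x ≠ 0 := fun k => by simp [hK]
  have hKy : ∀ k, k ∈ K ↔ wNorm (ω k) (p k) y ≠ 0 := fun k => by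
    rw [hKx, not_iff_not]
    have h1 := wNorm_le_of_le_smul (hω k) (hp0 k) hx hC.le hxy
    have h2 := wNorm_le_of_le_smul (hω k) (hp0 k) hy hD.le hyx
    constructor
    · intro h
      rw [h, mul_zero] at h2
      exact le_antisymm h2 (wNorm_nonneg (hω k) _ _)
    · intro h
      rw [h, mul_zero] at h1
      exact le_antisymm h1 (wNorm_nonneg (hω k) _ _)
  have hpos : ∀ z : Fin n → ℝ, z ≠ 0 → (∀ k, k ∈ K ↔ wNorm (ω k) (p k) z ≠ 0) →
      0 < (∏ k ∈ K, wNorm (ω k) (p k) z ^ max 0 (p k - s)) * sumNorm ω p s z ^ (s - 1) :=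
    fun z hz hKz => mul_pos (Finset.prod_pos fun k hk => Real.rpow_pos_of_pos
      (lt_of_le_of_ne (wNorm_nonneg (hω k) _ _) ((hKz k).mp hk).symm) _)
      (Real.rpow_pos_of_pos (sumNorm_pos hω hsum hp s hz) _)
  have hax := hpos x hx0 hKx
  have hay := hpos y hy0 hKy
  have h1 := prod_mul_sumNormGrad_le (s := s) hω hsum hp hC hx hy hx0 hy0 hxy hKx hKy
  have h2 := prod_mul_sumNormGrad_le (s := s) hω hsum hp hD hy hx hy0 hx0 hyx hKy hKx
  set a := (∏ k ∈ K, wNorm (ω k) (p k) x ^ max 0 (p k - s)) * sumNorm ω p s x ^ (s - 1)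
  set b := (∏ k ∈ K, wNorm (ω k) (p k) y ^ max 0 (p k - s)) * sumNorm ω p s y ^ (s - 1)
  set e := s - 1 + ∑ k ∈ K, max 0 (p k - s) with he
  have hCe := Real.rpow_pos_of_pos hC e
  have hDe := Real.rpow_pos_of_pos hD e
  have he0 : 0 ≤ e := add_nonneg (by linarith) (Finset.sum_nonneg fun k _ => le_max_left _ _)
  have hee : e ≤ expoFactor p s := by
    rw [he, expoFactor]
    gcongr
    exact Finset.subset_univ K
  refine ⟨C ^ e * b / a, D ^ e * a / b, by positivity, by positivity, fun i => ?_, fun i => ?_, ?_⟩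
  · rw [Pi.smul_apply, smul_eq_mul, div_mul_eq_mul_div, le_div_iff₀ hax]
    linarith [h1 i]
  · rw [Pi.smul_apply, smul_eq_mul, div_mul_eq_mul_div, le_div_iff₀ hay]
    linarith [h2 i]
  · calc C ^ e * b / a * (D ^ e * a / b) = (C * D) ^ e := by
          rw [Real.mul_rpow hC.le hD.le]
          field_simp
      _ ≤ Real.exp r ^ e := Real.rpow_le_rpow (by positivity) hCD he0
      _ = Real.exp (e * r) := by rw [← Real.exp_mul, mul_comm]
      _ ≤ Real.exp (expoFactor p s * r) :=
          Real.exp_le_exp.mpr (mul_le_mul_of_nonneg_right hee hr)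

end GradContraction

section InducedNorm

variable {m n : ℕ} {A : Matrix (Fin m) (Fin n) ℝ}

theorem mulVec_apply_pos (hA : ∀ i j, 0 ≤ A i j) {x : Fin n → ℝ} (hx : 0 ≤ x) {i : Fin m}
    {j : Fin n} (hij : 0 < A i j) (hj : 0 < x j) : 0 < (A *ᵥ x) i :=
  Finset.sum_pos' (fun l _ => mul_nonneg (hA i l) (hx l)) ⟨j, Finset.mem_univ j, mul_pos hij hj⟩

theorem exists_pos_of_transpose_mul_pos (hA : ∀ i j, 0 ≤ A i j) {i j : Fin n}
    (h : 0 < (Aᵀ * A) i j) : ∃ l, 0 < A l i ∧ 0 < A l j := by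
  rw [Matrix.mul_apply] at h
  obtain ⟨l, _, hl⟩ := Finset.exists_lt_of_sum_lt (s := Finset.univ) (f := fun _ => (0 : ℝ))
    (by simpa using h)
  exact ⟨l, pos_of_mul_pos_left hl (hA l j), pos_of_mul_pos_right hl (hA l i)⟩

theorem exists_pos_of_isIrreducible (hA : ∀ i j, 0 ≤ A i j) (hirr : (Aᵀ * A).IsIrreducible)
    (j : Fin n) : ∃ i, 0 < A i j := by
  obtain ⟨k, hk, hpos⟩ := (Matrix.isIrreducible_iff_exists_pow_pos hirr.nonneg).mp hirr j j
  obtain ⟨k, rfl⟩ := Nat.exists_eq_add_of_lt hk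
  rw [zero_add, pow_succ', Matrix.mul_apply] at hpos
  obtain ⟨l, _, hl⟩ := Finset.exists_lt_of_sum_lt (s := Finset.univ) (f := fun _ => (0 : ℝ))
    (by simpa using hpos)
  have h1 : 0 < (Aᵀ * A) j l :=
    pos_of_mul_pos_left hl (Matrix.pow_apply_nonneg hirr.nonneg k l j)
  obtain ⟨i, hi, _⟩ := exists_pos_of_transpose_mul_pos hA h1
  exact ⟨i, hi⟩

theorem pos_of_isIrreducible {M : Matrix (Fin n) (Fin n) ℝ} (hM : M.IsIrreducible)
    {x : Fin n → ℝ} (hx : 0 ≤ x) (hx0 : x ≠ 0) (h : ∀ i j, 0 < M i j → 0 < x j → 0 < x i)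
    (i : Fin n) : 0 < x i := by
  obtain ⟨j, hj⟩ := exists_pos_of_nonneg_of_ne_zero hx hx0
  have key : ∀ k i, 0 < (M ^ k) i j → 0 < x i := by
    intro k
    induction k with
    | zero =>
      intro i hi
      rcases eq_or_ne i j with rfl | hij
      · exact hj
      · simp [hij] at hi
    | succ k ih =>
      intro i hi
      rw [pow_succ', Matrix.mul_apply] at hi
      obtain ⟨l, _, hl⟩ := Finset.exists_lt_of_sum_lt (s := Finset.univ)
        (f := fun _ => (0 : ℝ)) (by simpa using hi)
      have h1 := pos_of_mul_pos_left hl (Matrix.pow_apply_nonneg hM.nonneg k l j)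
      have h2 := pos_of_mul_pos_right hl (hM.nonneg i l)
      exact h i l h1 (ih l h2)
  obtain ⟨k, _, hk⟩ := (Matrix.isIrreducible_iff_exists_pow_pos hM.nonneg).mp hM i j
  exact key k i hk

variable {α : (Fin m → ℝ) → ℝ} {N : (Fin n → ℝ) → ℝ}

theorem exists_isGreatest_normQuotients (hα : IsMonotoneNorm α) (hN : IsMonotoneNorm N)
    (hn : 0 < n) (A : Matrix (Fin m) (Fin n) ℝ) :
    ∃ y, N y = 1 ∧ IsGreatest (normQuotients A N α) (α (A *ᵥ y)) := by
  obtain ⟨y, hy, hmax⟩ := hN.exists_max_quotient hn (f := fun x => α (A *ᵥ x))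
    (hα.continuous.comp (Continuous.matrix_mulVec continuous_const continuous_id))
    (fun c hc x => by rw [Matrix.mulVec_smul, hα.smul_of_nonneg hc])
  have hy0 : y ≠ 0 := by
    rintro rfl
    rw [hN.map_zero] at hy
    exact zero_ne_one hy
  refine ⟨y, hy, ⟨y, hy0, by rw [hy, div_one]⟩, ?_⟩
  rintro r ⟨x, hx, rfl⟩
  exact hmax x hx

theorem isGreatest_inducedNorm (hα : IsMonotoneNorm α) (hN : IsMonotoneNorm N)
    (hn : 0 < n) (A : Matrix (Fin m) (Fin n) ℝ) :
    IsGreatest (normQuotients A N α) (inducedNorm A N α) := by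
  obtain ⟨y, _, hy⟩ := exists_isGreatest_normQuotients hα hN hn A
  rwa [inducedNorm, hy.csSup_eq]

theorem le_inducedNorm_mul (hα : IsMonotoneNorm α) (hN : IsMonotoneNorm N)
    (hn : 0 < n) (A : Matrix (Fin m) (Fin n) ℝ) (x : Fin n → ℝ) :
    α (A *ᵥ x) ≤ inducedNorm A N α * N x := by
  rcases eq_or_ne x 0 with rfl | hx
  · rw [Matrix.mulVec_zero, hα.map_zero, hN.map_zero, mul_zero]
  · exact (div_le_iff₀ (hN.pos hx)).mp
      ((isGreatest_inducedNorm hα hN hn A).2 ⟨x, hx, rfl⟩)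

theorem exists_nonneg_maximizer (hA : ∀ i j, 0 ≤ A i j) (hα : IsMonotoneNorm α)
    (hN : IsMonotoneNorm N) (hn : 0 < n) :
    ∃ y, 0 ≤ y ∧ N y = 1 ∧ α (A *ᵥ y) = inducedNorm A N α := by
  obtain ⟨y, hy, hmax⟩ := exists_isGreatest_normQuotients hα hN hn A
  have h1 : N (fun i => |y i|) = 1 := by
    rw [← hy]
    exact le_antisymm (hN.mono _ _ fun i => by simp) (hN.mono _ _ fun i => by simp)
  refine ⟨fun i => |y i|, fun i => abs_nonneg _, h1, le_antisymm ?_ ?_⟩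
  · simpa [h1] using le_inducedNorm_mul hα hN hn A fun i => |y i|
  · rw [inducedNorm, hmax.csSup_eq]
    refine hα.mono _ _ fun i => le_trans ?_ (le_abs_self _)
    simp only [Matrix.mulVec, dotProduct]
    refine (Finset.abs_sum_le_sum_abs _ _).trans (Finset.sum_le_sum fun j _ => ?_)
    rw [abs_mul, abs_of_nonneg (hA i j)]

theorem powerMap_dualNorm (hN : IsMonotoneNorm N) (hd : NormDifferentiable N) (hn : 0 < n)
    (A : Matrix (Fin m) (Fin n) ℝ) (α : (Fin m → ℝ) → ℝ) (x : Fin n → ℝ) :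
    powerMap A (dualNorm N) α x = normGradient N (Aᵀ *ᵥ normGradient α (A *ᵥ x)) := by
  rw [powerMap, hN.dualNorm_dualNorm hd hn]

/-- Maximizers of unit norm are fixed points of the power map. -/
theorem powerMap_eq_self (hα : IsMonotoneNorm α) (hαd : NormDifferentiable α)
    (hN : IsMonotoneNorm N) (hd : NormDifferentiable N) (hn : 0 < n) {x : Fin n → ℝ}
    (hx : dualNorm N x = 1) (hmax : α (A *ᵥ x) = inducedNorm A (dualNorm N) α)
    (hAx : A *ᵥ x ≠ 0) : powerMap A (dualNorm N) α x = x := by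
  rw [powerMap_dualNorm hN hd hn]
  have hD := hN.dualNorm hn
  set g := Aᵀ *ᵥ normGradient α (A *ᵥ x) with hg
  have hgz : ∀ z, g ⬝ᵥ z = normGradient α (A *ᵥ x) ⬝ᵥ (A *ᵥ z) := fun z => by
    rw [hg, Matrix.mulVec_transpose, Matrix.dotProduct_mulVec]
  have h1 : g ⬝ᵥ x = α (A *ᵥ x) := by
    rw [hgz, hα.normGradient_dotProduct_self hαd hAx]
  have h2 : N g ≤ α (A *ᵥ x) := by
    conv_lhs => rw [← hN.dualNorm_dualNorm hd hn]
    refine hD.dualNorm_le hn fun z => ?_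
    rw [hgz, hmax]
    exact (hα.normGradient_dotProduct_le hαd hAx _).trans (le_inducedNorm_mul hα hD hn A z)
  have h3 : ∀ z, x ⬝ᵥ z ≤ N z := fun z => by
    simpa [hx] using hN.dotProduct_le x z
  have h4 : x ⬝ᵥ g = N g := by
    refine le_antisymm (h3 g) ?_
    rw [dotProduct_comm, h1]
    exact h2
  have hg0 : g ≠ 0 := by
    intro h
    rw [h, zero_dotProduct] at h1
    exact (hα.pos hAx).ne h1
  exact (IsMonotoneNorm.eq_normGradient hd hg0 h4 h3).symm

theorem exists_orderClose_of_pos {x y : Fin n → ℝ} (hx : ∀ i, 0 < x i) (hy : ∀ i, 0 < y i) :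
    ∃ r, 0 ≤ r ∧ OrderClose r x y := by
  have key : ∀ x y : Fin n → ℝ, (∀ i, 0 < x i) → (∀ i, 0 < y i) →
      ∃ C : ℝ, 0 < C ∧ x ≤ C • y := fun x y hx hy => by
    refine ⟨1 + ∑ i, x i / y i, add_pos_of_pos_of_nonneg one_pos
      (Finset.sum_nonneg fun i _ => (div_pos (hx i) (hy i)).le), fun i => ?_⟩
    rw [Pi.smul_apply, smul_eq_mul, ← div_le_iff₀ (hy i)]
    have := Finset.single_le_sum (f := fun i => x i / y i)
      (fun i _ => (div_pos (hx i) (hy i)).le) (Finset.mem_univ i)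
    linarith
  obtain ⟨C, hC, hxy⟩ := key x y hx hy
  obtain ⟨D, hD, hyx⟩ := key y x hy hx
  refine ⟨max 0 (Real.log (C * D)), le_max_left _ _, C, D, hC, hD, hxy, hyx, ?_⟩
  rw [← Real.log_le_iff_le_exp (mul_pos hC hD)]
  exact le_max_right _ _

end InducedNorm

section Convergence

variable {m n d h : ℕ} {A : Matrix (Fin m) (Fin n) ℝ} {ω : Fin d → Fin m → ℝ} {p : Fin d → ℝ}
  {s : ℝ} {ϖ : Fin h → Fin n → ℝ} {q : Fin h → ℝ} {t : ℝ}

/-- The explicit form of the power map. -/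
noncomputable def sumPowerMap (A : Matrix (Fin m) (Fin n) ℝ) (ω : Fin d → Fin m → ℝ) (p : Fin d → ℝ) (s : ℝ)
    (ϖ : Fin h → Fin n → ℝ) (q : Fin h → ℝ) (t : ℝ) (x : Fin n → ℝ) : Fin n → ℝ :=
  sumNormGrad ϖ q t (Aᵀ *ᵥ sumNormGrad ω p s (A *ᵥ x))

theorem powerMap_eq_sumPowerMap (hn : 0 < n) (hω : ∀ k i, 0 ≤ ω k i)
    (hωs : ∀ i, 0 < ∑ k, ω k i) (hp : ∀ k, 1 < p k) (hs : 1 ≤ s) (hϖ : ∀ k j, 0 ≤ ϖ k j)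
    (hϖs : ∀ j, 0 < ∑ k, ϖ k j) (hq : ∀ k, 1 < q k) (ht : 1 ≤ t)
    (hα : NormDifferentiable (sumNorm ω p s)) (hγ : NormDifferentiable (sumNorm ϖ q t))
    (x : Fin n → ℝ) :
    powerMap A (dualNorm (sumNorm ϖ q t)) (sumNorm ω p s) x = sumPowerMap A ω p s ϖ q t x := by
  rw [powerMap_dualNorm (isMonotoneNorm_sumNorm hϖ hϖs hq ht) hγ hn, sumPowerMap,
    normGradient_sumNorm hω hωs hp hs hα, normGradient_sumNorm hϖ hϖs hq ht hγ]

theorem sumPowerMap_apply_pos (hA : ∀ i j, 0 ≤ A i j) (hω : ∀ k i, 0 ≤ ω k i)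
    (hωs : ∀ i, 0 < ∑ k, ω k i) (hp : ∀ k, 1 < p k) (hϖ : ∀ k j, 0 ≤ ϖ k j)
    (hϖs : ∀ j, 0 < ∑ k, ϖ k j) (hq : ∀ k, 1 < q k) {x : Fin n → ℝ} (hx : 0 ≤ x)
    {l : Fin m} {i j : Fin n} (hi : 0 < A l i) (hj : 0 < A l j) (hxj : 0 < x j) :
    0 < sumPowerMap A ω p s ϖ q t x i := by
  have hAx := mulVec_nonneg hA hx
  have hG := sumNormGrad_nonneg (p := p) (s := s) hω hAx
  have hA' : ∀ i j, 0 ≤ Aᵀ i j := fun i j => hA j i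
  exact sumNormGrad_pos hϖ hϖs hq (mulVec_nonneg hA' hG)
    (mulVec_apply_pos hA' hG (i := i) (j := l) hi
      (sumNormGrad_pos hω hωs hp hAx (mulVec_apply_pos hA hx hj hxj)))

theorem OrderClose.sumPowerMap (hA : ∀ i j, 0 ≤ A i j) (hcol : ∀ j, ∃ i, 0 < A i j)
    (hω : ∀ k i, 0 ≤ ω k i)
    (hωs : ∀ i, 0 < ∑ k, ω k i) (hp : ∀ k, 1 < p k) (hs : 1 ≤ s) (hϖ : ∀ k j, 0 ≤ ϖ k j)
    (hϖs : ∀ j, 0 < ∑ k, ϖ k j) (hq : ∀ k, 1 < q k) (ht : 1 ≤ t) {a b : ℝ} (ha0 : 0 ≤ a)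
    (hb0 : 0 ≤ b)
    (ha : birkhoffRatio (fun x : Fin n → ℝ => A *ᵥ x) < ENNReal.ofReal a)
    (hb : birkhoffRatio (fun x : Fin m → ℝ => Aᵀ *ᵥ x) < ENNReal.ofReal b)
    {x y : Fin n → ℝ} {r : ℝ} (hr : 0 ≤ r) (hx : 0 ≤ x) (hy : 0 ≤ y) (hx0 : x ≠ 0)
    (hxy : OrderClose r x y) :
    OrderClose (a * b * expoFactor p s * expoFactor q t * r)
      (sumPowerMap A ω p s ϖ q t x) (sumPowerMap A ω p s ϖ q t y) := by
  obtain ⟨j, hj⟩ := exists_pos_of_nonneg_of_ne_zero hx hx0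
  obtain ⟨l, hl⟩ := hcol j
  have hA' : ∀ i j, 0 ≤ Aᵀ i j := fun i j => hA j i
  have hAx := mulVec_nonneg hA hx
  have hAy := mulVec_nonneg hA hy
  have hAxl := mulVec_apply_pos hA hx hl hj
  have hGx := sumNormGrad_nonneg (p := p) (s := s) hω hAx
  have hGy := sumNormGrad_nonneg (p := p) (s := s) hω hAy
  have hBl := mulVec_apply_pos hA' hGx (i := j) (j := l) hl (sumNormGrad_pos hω hωs hp hAx hAxl)
  have hAx0 : A *ᵥ x ≠ 0 := fun h => hAxl.ne' (congrFun h l)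
  have hBx0 : Aᵀ *ᵥ _root_.sumNormGrad ω p s (A *ᵥ x) ≠ 0 := fun h => hBl.ne' (congrFun h j)
  have he := expoFactor_nonneg p hs
  have h1 := hxy.mulVec_of_birkhoffRatio_lt hA ha hr hx hy hAx0
  have h2 := h1.sumNormGrad hω hωs hp hs (by positivity) hAx hAy hAx0
  have h3 := h2.mulVec_of_birkhoffRatio_lt hA' hb (by positivity) hGx hGy hBx0
  have h4 := h3.sumNormGrad hϖ hϖs hq ht (by positivity) (mulVec_nonneg hA' hGx)
    (mulVec_nonneg hA' hGy) hBx0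
  have hr' : a * b * expoFactor p s * expoFactor q t * r =
      expoFactor q t * (b * (expoFactor p s * (a * r))) := by ring
  rwa [hr']

/-- Linear convergence of the power method. -/
theorem powerSeq_linear_convergence (hn : 0 < n) (hA : ∀ i j, 0 ≤ A i j)
    (hirr : (Aᵀ * A).IsIrreducible) (hω : ∀ k i, 0 ≤ ω k i)
    (hωs : ∀ i, 0 < ∑ k, ω k i) (hp : ∀ k, 1 < p k) (hs : 1 ≤ s) (hϖ : ∀ k j, 0 ≤ ϖ k j)
    (hϖs : ∀ j, 0 < ∑ k, ϖ k j) (hq : ∀ k, 1 < q k) (ht : 1 ≤ t)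
    (hα : NormDifferentiable (sumNorm ω p s)) (hγ : NormDifferentiable (sumNorm ϖ q t))
    (hτ : tauBound A p s q t < 1) {x₀ : Fin n → ℝ} (hx₀ : ∀ j, 0 < x₀ j) :
    ∃ ρ R : ℝ, 0 ≤ ρ ∧ ρ < 1 ∧ 0 ≤ R ∧ ∀ l,
      inducedNorm A (dualNorm (sumNorm ϖ q t)) (sumNorm ω p s) - R * ρ ^ l ≤ sumNorm ω p s
        (A *ᵥ powerSeq A (dualNorm (sumNorm ϖ q t)) (sumNorm ω p s) x₀ l) ∧
      sumNorm ω p s (A *ᵥ powerSeq A (dualNorm (sumNorm ϖ q t)) (sumNorm ω p s) x₀ l) ≤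
        inducedNorm A (dualNorm (sumNorm ϖ q t)) (sumNorm ω p s) := by
  have hαN := isMonotoneNorm_sumNorm hω hωs hp hs
  have hγN := isMonotoneNorm_sumNorm hϖ hϖs hq ht
  have hβN := hγN.dualNorm hn
  have hcol := exists_pos_of_isIrreducible hA hirr
  have hS := powerMap_eq_sumPowerMap (A := A) hn hω hωs hp hs hϖ hϖs hq ht hα hγ
  have hSpos : ∀ x : Fin n → ℝ, (∀ j, 0 < x j) → ∀ j, 0 < sumPowerMap A ω p s ϖ q t x j :=
    fun x hx j => by
      obtain ⟨l, hl⟩ := hcol j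
      exact sumPowerMap_apply_pos hA hω hωs hp hϖ hϖs hq (fun i => (hx i).le) hl hl (hx j)
  have hne : ∀ x : Fin n → ℝ, (∀ j, 0 < x j) → x ≠ 0 := fun x hx h =>
    (hx ⟨0, hn⟩).ne' (congrFun h _)
  obtain ⟨z, hz, hz1, hzmax⟩ := exists_nonneg_maximizer hA hαN hβN hn
  set β := dualNorm (sumNorm ϖ q t) with hβ
  set α := sumNorm ω p s with hαdef
  set lam := inducedNorm A β α with hlam
  have hz0 : z ≠ 0 := by
    rintro rfl
    rw [hβN.map_zero] at hz1
    exact zero_ne_one hz1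
  have hAz : A *ᵥ z ≠ 0 := by
    obtain ⟨j, hj⟩ := exists_pos_of_nonneg_of_ne_zero hz hz0
    obtain ⟨l, hl⟩ := hcol j
    exact fun h => (mulVec_apply_pos hA hz hl hj).ne' (congrFun h l)
  have hlam0 : 0 < lam := by
    rw [← hzmax]
    exact hαN.pos hAz
  have hfix : sumPowerMap A ω p s ϖ q t z = z := by
    rw [← hS]
    exact powerMap_eq_self hαN hα hγN hγ hn hz1 hzmax hAz
  have hzpos : ∀ j, 0 < z j := pos_of_isIrreducible hirr hz hz0 fun i j hij hj => by
    obtain ⟨l, hli, hlj⟩ := exists_pos_of_transpose_mul_pos hA hij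
    rw [← hfix]
    exact sumPowerMap_apply_pos hA hω hωs hp hϖ hϖs hq hz hli hlj hj
  have hseqpos : ∀ l j, 0 < powerSeq A β α x₀ l j := by
    intro l
    induction l with
    | zero =>
      intro j
      exact mul_pos (inv_pos.mpr (hβN.pos (hne x₀ hx₀))) (hx₀ j)
    | succ l ih =>
      rw [powerSeq, hS]
      exact hSpos _ ih
  have hseqnorm : ∀ l, β (powerSeq A β α x₀ l) = 1 := by
    intro l
    cases l with
    | zero =>
      have h0 := hβN.pos (hne x₀ hx₀)
      rw [powerSeq, hβN.smul_of_nonneg (inv_nonneg.mpr h0.le), inv_mul_cancel₀ h0.ne']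
    | succ l =>
      rw [powerSeq, hβ, powerMap_dualNorm hγN hγ hn]
      refine hγN.dualNorm_normGradient hγ hn fun h => ?_
      have h1 := hseqpos (l + 1) ⟨0, hn⟩
      rw [powerSeq, hβ, powerMap_dualNorm hγN hγ hn, h, normGradient, if_pos rfl] at h1
      exact lt_irrefl _ h1
  obtain ⟨a, b, ha0, hb0, hab, ha, hb⟩ := exists_contraction_constants hA hs hτ
  set ρ := a * b * expoFactor p s * expoFactor q t with hρ
  have hρ0 : 0 ≤ ρ := mul_nonneg (mul_nonneg (by positivity) (expoFactor_nonneg p hs))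
    (expoFactor_nonneg q ht)
  obtain ⟨r, hr, hclose⟩ := exists_orderClose_of_pos (hseqpos 0) hzpos
  have hcl : ∀ l, OrderClose (ρ ^ l * r) (powerSeq A β α x₀ l) z := by
    intro l
    induction l with
    | zero => simpa using hclose
    | succ l ih =>
      have h1 := ih.sumPowerMap hA hcol hω hωs hp hs hϖ hϖs hq ht ha0.le hb0.le ha hb
        (by positivity) (fun j => (hseqpos l j).le) hz (hne _ (hseqpos l))
      rw [hfix, ← hS] at h1
      rw [powerSeq, pow_succ', mul_assoc]
      exact h1
  refine ⟨ρ, lam * r, hρ0, hab, by positivity, fun l => ?_⟩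
  have hx := hseqpos l
  have hupper := le_inducedNorm_mul hαN hβN hn A (powerSeq A β α x₀ l)
  rw [hseqnorm l, mul_one] at hupper
  refine ⟨?_, hupper⟩
  obtain ⟨C, D, hC, hD, hxz, hzx, hCD⟩ := hcl l
  set x := powerSeq A β α x₀ l with hxdef
  have hx0 : 0 ≤ x := fun j => (hx j).le
  have hC1 : 1 ≤ C := by
    have := hβN.le_of_le hx0 hxz
    rwa [hseqnorm l, hβN.smul_of_nonneg hC.le, hz1, mul_one] at this
  have hDexp : D ≤ Real.exp (ρ ^ l * r) := (le_mul_of_one_le_left hD.le hC1).trans hCD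
  have h1 : lam ≤ D * α (A *ᵥ x) := by
    rw [← hzmax, ← hαN.smul_of_nonneg hD.le, ← Matrix.mulVec_smul]
    exact hαN.le_of_le (mulVec_nonneg hA hz) (mulVec_le_mulVec hA hzx)
  have h2 : lam * Real.exp (-(ρ ^ l * r)) ≤ α (A *ᵥ x) := by
    rw [Real.exp_neg, ← div_eq_mul_inv, div_le_iff₀ (Real.exp_pos _), mul_comm]
    exact h1.trans (mul_le_mul_of_nonneg_right hDexp (hαN.nonneg _))
  have h3 := Real.add_one_le_exp (-(ρ ^ l * r))
  nlinarith [mul_le_mul_of_nonneg_left h3 hlam0.le]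

/-- Linear convergence reaches every precision `ε` in `O(ln (1/ε))` steps. -/
theorem exists_log_steps {ρ R : ℝ} (hρ0 : 0 ≤ ρ) (hρ1 : ρ < 1) (hR : 0 ≤ R) :
    ∃ K : ℝ, 0 < K ∧ ∀ ε : ℝ, 0 < ε → ε ≤ 1 / 2 →
      ∃ k : ℕ, 1 ≤ k ∧ (k : ℝ) ≤ K * Real.log (1 / ε) ∧ ∀ l, k ≤ l → R * ρ ^ l ≤ ε := by
  obtain ⟨a, ha⟩ := exists_pow_lt_of_lt_one (inv_pos.mpr (by linarith : 0 < R + 1)) hρ1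
  obtain ⟨b, hb⟩ := exists_pow_lt_of_lt_one (Real.exp_pos (-1)) hρ1
  have hlog2 : 0 < Real.log 2 := Real.log_pos one_lt_two
  refine ⟨(a + b + 1) / Real.log 2 + b, by positivity, fun ε hε hε2 => ?_⟩
  have hL : Real.log 2 ≤ Real.log (1 / ε) := by
    refine Real.log_le_log two_pos ?_
    rw [le_div_iff₀ hε]
    linarith
  have hL0 : 0 < Real.log (1 / ε) := hlog2.trans_le hL
  set L := Real.log (1 / ε) with hLdef
  refine ⟨a + b * ⌈L⌉₊ + 1, by omega, ?_, fun l hl => ?_⟩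
  · have h1 : (⌈L⌉₊ : ℝ) ≤ L + 1 := (Nat.ceil_lt_add_one hL0.le).le
    push_cast
    have h2 : (a + b + 1 : ℝ) ≤ (a + b + 1) / Real.log 2 * L := by
      rw [div_mul_eq_mul_div, le_div_iff₀ hlog2]
      exact mul_le_mul_of_nonneg_left hL (by positivity)
    nlinarith [mul_le_mul_of_nonneg_left h1 (Nat.cast_nonneg b : (0 : ℝ) ≤ b)]
  · have h1 : ρ ^ l ≤ ρ ^ (a + b * ⌈L⌉₊) := pow_le_pow_of_le_one hρ0 hρ1.le (by omega)
    have h2 : (ρ ^ b) ^ ⌈L⌉₊ ≤ ε := by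
      calc (ρ ^ b) ^ ⌈L⌉₊ ≤ Real.exp (-1) ^ ⌈L⌉₊ := pow_le_pow_left₀ (by positivity) hb.le _
        _ = Real.exp (-⌈L⌉₊) := by rw [← Real.exp_nat_mul]; simp
        _ ≤ Real.exp (-L) := Real.exp_le_exp.mpr (neg_le_neg (Nat.le_ceil L))
        _ = ε := by rw [hLdef, one_div, Real.log_inv, neg_neg, Real.exp_log hε]
    have h3 : R * ρ ^ a ≤ 1 := by
      have : (R + 1) * ρ ^ a ≤ 1 := by
        rw [mul_comm, ← le_div_iff₀ (by linarith), one_div]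
        exact ha.le
      nlinarith [pow_nonneg hρ0 a]
    calc R * ρ ^ l ≤ R * ρ ^ (a + b * ⌈L⌉₊) := mul_le_mul_of_nonneg_left h1 hR
      _ = R * ρ ^ a * (ρ ^ b) ^ ⌈L⌉₊ := by rw [pow_add, pow_mul]; ring
      _ ≤ 1 * ε := mul_le_mul h3 h2 (by positivity) zero_le_one
      _ = ε := one_mul ε

end Convergence

section Reach

variable {V : Type}

/-- From the functions in `S`, at most `N` arithmetic operations, carried out uniformly in the
parameter `v : V`, produce all functions in `T`. -/
inductive Reach : Set (V → ℝ) → ℕ → Set (V → ℝ) → Prop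
  | base {S T : Set (V → ℝ)} {N : ℕ} (h : T ⊆ S) : Reach S N T
  | step {S T : Set (V → ℝ)} {N : ℕ} {a b f : V → ℝ} (o : ArithOp) (ha : a ∈ S) (hb : b ∈ S)
      (hf : ∀ v, o.eval (a v) (b v) = some (f v)) (h : Reach (insert f S) N T) :
      Reach S (N + 1) T

namespace Reach

variable {S S' T T' U : Set (V → ℝ)} {N M : ℕ} {a b f : V → ℝ}

theorem mono_left (h : Reach S N T) : ∀ {S'}, S ⊆ S' → Reach S' N T := by
  induction h with
  | base h => exact fun hS => .base (h.trans hS)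
  | step o ha hb hf _ ih =>
    exact fun hS => .step o (hS ha) (hS hb) hf (ih (Set.insert_subset_insert hS))

theorem mono_right (h : Reach S N T) (hT : T' ⊆ T) : Reach S N T' := by
  induction h with
  | base h => exact .base (hT.trans h)
  | step o ha hb hf _ ih => exact .step o ha hb hf (ih hT)

theorem mono_cost (h : Reach S N T) : ∀ {M}, N ≤ M → Reach S M T := by
  induction h with
  | base h => exact fun _ => .base h
  | step o ha hb hf _ ih =>
    intro M hM
    obtain ⟨M, rfl⟩ := Nat.exists_eq_add_of_le' (Nat.le_of_add_left_le hM)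
    exact .step o ha hb hf (ih (by omega))

theorem trans (h : Reach S N T) : ∀ {M U}, Reach (S ∪ T) M U → Reach S (N + M) U := by
  induction h with
  | base h =>
    intro M U hU
    rw [Set.union_eq_self_of_subset_right h] at hU
    exact hU.mono_cost (by omega)
  | step o ha hb hf _ ih =>
    intro M U hU
    rw [add_right_comm]
    exact .step o ha hb hf (ih (hU.mono_left (Set.union_subset_union_left _
      (Set.subset_insert _ _))))

theorem union_left (h : Reach S N T) : Reach S N (S ∪ T) :=
  h.trans (M := 0) (.base subset_rfl)

theorem union (h : Reach S N T) (h' : Reach S M U) : Reach S (N + M) (T ∪ U) := by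
  refine h.trans ((h'.mono_left Set.subset_union_left).union_left.mono_right ?_)
  exact Set.union_subset_union_left _ Set.subset_union_right

theorem biUnion {ι : Type*} {s : Finset ι} {c : ι → ℕ} {F : ι → Set (V → ℝ)}
    (h : ∀ i ∈ s, Reach S (c i) (F i)) : Reach S (∑ i ∈ s, c i) {f | ∃ i ∈ s, f ∈ F i} := by
  classical
  induction s using Finset.induction_on with
  | empty => exact .base fun f hf => by simp at hf
  | insert i s hi ih =>
    rw [Finset.sum_insert hi]
    refine ((h i (Finset.mem_insert_self i s)).union
      (ih fun j hj => h j (Finset.mem_insert_of_mem hj))).mono_right ?_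
    rintro f ⟨j, hj, hf⟩
    rcases Finset.mem_insert.mp hj with rfl | hj
    exacts [Or.inl hf, Or.inr ⟨j, hj, hf⟩]

theorem of_mem (h : f ∈ S) : Reach S 0 {f} := .base (Set.singleton_subset_iff.mpr h)

theorem binop (o : ArithOp) (ha : Reach S N {a}) (hb : Reach S M {b})
    (hf : ∀ v, o.eval (a v) (b v) = some (f v)) : Reach S (N + M + 1) {f} :=
  (ha.union hb).trans (.step (N := 0) o (by simp) (by simp) hf (.base (by simp)))

theorem add (ha : Reach S N {a}) (hb : Reach S M {b}) :
    Reach S (N + M + 1) {fun v => a v + b v} :=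
  binop .add ha hb fun _ => rfl

theorem sub (ha : Reach S N {a}) (hb : Reach S M {b}) :
    Reach S (N + M + 1) {fun v => a v - b v} :=
  binop .sub ha hb fun _ => rfl

theorem mul (ha : Reach S N {a}) (hb : Reach S M {b}) :
    Reach S (N + M + 1) {fun v => a v * b v} :=
  binop .mul ha hb fun _ => rfl

theorem div (ha : Reach S N {a}) (hb : Reach S M {b}) (h0 : ∀ v, b v ≠ 0) :
    Reach S (N + M + 1) {fun v => a v / b v} :=
  binop .div ha hb fun v => by simp [ArithOp.eval, h0 v]

theorem pow (ha : Reach S N {a}) (hb : Reach S M {b}) (h0 : ∀ v, 0 < a v) :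
    Reach S (N + M + 1) {fun v => a v ^ b v} :=
  binop .pow ha hb fun v => by simp [ArithOp.eval, h0 v]

theorem sum {ι : Type*} {s : Finset ι} {c : ι → ℕ} {F : ι → V → ℝ}
    (h0 : (fun _ => ((0 : ℕ) : ℝ)) ∈ S) (h : ∀ i ∈ s, Reach S (c i) {F i}) :
    Reach S (∑ i ∈ s, (c i + 1)) {fun v => ∑ i ∈ s, F i v} := by
  classical
  induction s using Finset.induction_on with
  | empty => simpa using of_mem h0
  | insert i s hi ih =>
    rw [Finset.sum_insert hi]
    have := (h i (Finset.mem_insert_self i s)).add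
      (ih fun j hj => h j (Finset.mem_insert_of_mem hj))
    simp only [Finset.sum_insert hi]
    exact this.mono_cost (by omega)

end Reach

end Reach

section Compile

variable {V ι : Type} {inp : V → ι → ℝ}

theorem Program.run_append (x : ι → ℝ) (P Q : Program ι) (regs : List ℝ) :
    Program.run x (P ++ Q) regs = (Program.run x P regs).bind (Program.run x Q) := by
  induction P generalizing regs with
  | nil => rfl
  | cons I P ih => simp [Program.run, ih, Option.bind_assoc]

theorem Operand.eval_append {x : ι → ℝ} {regs : List ℝ} {o : Operand ι} {a : ℝ}
    (h : o.eval x regs = some a) (regs' : List ℝ) : o.eval x (regs ++ regs') = some a := by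
  cases o with
  | inp i => exact h
  | lit c => exact h
  | reg k =>
    have hk : k < regs.length := by
      by_contra hk
      simp [Operand.eval, not_lt.mp hk] at h
    simp only [Operand.eval] at h ⊢
    rwa [List.getElem?_append_left hk]

/-- The program `P` produces the results `regs v` on the inputs `inp v`. -/
def Realizes (inp : V → ι → ℝ) (P : Program ι) (regs : V → List ℝ) : Prop :=
  ∀ v, Program.run (inp v) P [] = some (regs v) ∧ (regs v).length = P.length

/-- The functions that can be read off from the inputs and the results `regs`. -/
def available (inp : V → ι → ℝ) (regs : V → List ℝ) : Set (V → ℝ) :=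
  {f | ∃ o : Operand ι, ∀ v, o.eval (inp v) (regs v) = some (f v)}

theorem Realizes.snoc {P : Program ι} {regs : V → List ℝ} (h : Realizes inp P regs)
    {a b f : V → ℝ} (o : ArithOp) (ha : a ∈ available inp regs) (hb : b ∈ available inp regs)
    (hf : ∀ v, o.eval (a v) (b v) = some (f v)) :
    ∃ I : Instr ι, Realizes inp (P ++ [I]) (fun v => regs v ++ [f v]) ∧
      insert f (available inp regs) ⊆ available inp (fun v => regs v ++ [f v]) := by
  obtain ⟨oa, ha⟩ := ha
  obtain ⟨ob, hb⟩ := hb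
  refine ⟨⟨o, oa, ob⟩, fun v => ⟨?_, by simp [(h v).2]⟩, ?_⟩
  · rw [Program.run_append, (h v).1]
    simp [Program.run, ha v, hb v, hf v]
  · rintro g (rfl | ⟨og, hg⟩)
    · exact ⟨.reg P.length, fun v => by simp [Operand.eval, ← (h v).2]⟩
    · exact ⟨og, fun v => Operand.eval_append (hg v) _⟩

theorem Reach.exists_realizes {S T : Set (V → ℝ)} {N : ℕ} (h : Reach S N T) :
    ∀ {P : Program ι} {regs : V → List ℝ}, Realizes inp P regs → S ⊆ available inp regs →
      ∃ (P' : Program ι) (regs' : V → List ℝ), Realizes inp P' regs' ∧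
        P'.length ≤ P.length + N ∧ T ⊆ available inp regs' := by
  induction h with
  | base h => exact fun hP hS => ⟨_, _, hP, by omega, h.trans hS⟩
  | step o ha hb hf _ ih =>
    intro P regs hP hS
    obtain ⟨I, hI, hsub⟩ := hP.snoc o (hS ha) (hS hb) hf
    obtain ⟨P', regs', h1, h2, h3⟩ := ih hI ((Set.insert_subset_insert hS).trans hsub)
    exact ⟨P', regs', h1, by simp at h2; omega, h3⟩

theorem Realizes.exists_copy {P : Program ι} {regs : V → List ℝ} (h : Realizes inp P regs)
    (L : List (V → ℝ)) (hL : ∀ f ∈ L, f ∈ available inp regs) :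
    ∃ P' : Program ι, P'.length = P.length + L.length ∧
      Realizes inp P' (fun v => regs v ++ L.map fun f => f v) := by
  induction L generalizing P regs with
  | nil => exact ⟨P, by simp, by simpa using h⟩
  | cons f L ih =>
    obtain ⟨I, hI, hsub⟩ := h.snoc (f := f) (b := fun _ => ((0 : ℕ) : ℝ)) .add
      (hL f (by simp)) ⟨.lit 0, fun _ => rfl⟩ (fun v => by simp [ArithOp.eval])
    obtain ⟨P', h1, h2⟩ := ih hI fun g hg => hsub (Or.inr (hL g (by simp [hg])))
    refine ⟨P', by simp at h1 ⊢; omega, ?_⟩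
    simpa using h2

/-- The functions available before any operation: inputs and literals. -/
def initial (inp : V → ι → ℝ) : Set (V → ℝ) :=
  {f | (∃ i, f = fun v => inp v i) ∨ ∃ c : ℕ, f = fun _ => (c : ℝ)}

theorem Reach.exists_program {T : Set (V → ℝ)} {N : ℕ} (h : Reach (initial inp) N T)
    (L : List (V → ℝ)) (hL : ∀ f ∈ L, f ∈ T) :
    ∃ P : Program ι, P.length ≤ N + L.length ∧
      ∀ v, P.Outputs (inp v) (L.map fun f => f v) := by
  have h0 : Realizes inp ([] : Program ι) (fun _ => []) := fun v => ⟨rfl, rfl⟩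
  obtain ⟨P, regs, h1, h2, h3⟩ := h.exists_realizes h0 (by
    rintro f (⟨i, rfl⟩ | ⟨c, rfl⟩)
    exacts [⟨.inp i, fun _ => rfl⟩, ⟨.lit c, fun _ => rfl⟩])
  obtain ⟨P', h4, h5⟩ := h1.exists_copy L fun f hf => h3 (hL f hf)
  refine ⟨P', by simp at h2; omega, fun v => ⟨_, (h5 v).1, List.suffix_append _ _⟩⟩

end Compile

section Costs

variable {V : Type} {S : Set (V → ℝ)}

theorem reach_mulVec {a b : ℕ} {M : V → Matrix (Fin a) (Fin b) ℝ} {x : V → Fin b → ℝ}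
    {cols : Fin a → Finset (Fin b)} (hlit : ∀ c : ℕ, (fun _ => (c : ℝ)) ∈ S)
    (hM : ∀ i j, (fun v => M v i j) ∈ S) (hx : ∀ i, ∀ j ∈ cols i, (fun v => x v j) ∈ S)
    (hcols : ∀ v i j, j ∉ cols i → M v i j = 0) :
    Reach S (2 * ∑ i, (cols i).card) {f | ∃ i, f = fun v => (M v *ᵥ x v) i} := by
  have h : ∀ i ∈ Finset.univ, Reach S (2 * (cols i).card) {fun v => (M v *ᵥ x v) i} := by
    intro i _
    have h1 := Reach.sum (s := cols i) (hlit 0)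
      fun j hj => (Reach.of_mem (hM i j)).mul (Reach.of_mem (hx i j hj))
    have h2 : (fun v => (M v *ᵥ x v) i) = fun v => ∑ j ∈ cols i, M v i j * x v j := by
      funext v
      rw [Matrix.mulVec, dotProduct]
      exact (Finset.sum_subset (Finset.subset_univ _)
        fun j _ hj => by rw [hcols v i j hj, zero_mul]).symm
    rw [h2]
    exact h1.mono_cost (by simp [mul_comm])
  rw [Finset.mul_sum]
  refine (Reach.biUnion h).mono_right ?_
  rintro f ⟨i, rfl⟩
  exact ⟨i, Finset.mem_univ i, rfl⟩

/-- The cost of evaluating a sum of weighted norms and its gradient at a nonnegative vector with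
support `R`. -/
theorem reach_sumNormGrad {n d : ℕ} {W : V → Fin d → Fin n → ℝ} {p : V → Fin d → ℝ}
    {s : V → ℝ} {y : V → Fin n → ℝ} {Z : Fin d → Finset (Fin n)} {R : Finset (Fin n)}
    (hlit : ∀ c : ℕ, (fun _ => (c : ℝ)) ∈ S)
    (hW : ∀ k i, (fun v => W v k i) ∈ S) (hp : ∀ k, (fun v => p v k) ∈ S) (hs : s ∈ S)
    (hy : ∀ i ∈ R, (fun v => y v i) ∈ S) (hZ : ∀ v k i, i ∈ Z k ↔ W v k i ≠ 0)
    (hW0 : ∀ v k i, 0 ≤ W v k i) (hsum : ∀ v i, 0 < ∑ k, W v k i)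
    (hp1 : ∀ v k, 1 < p v k) (hs1 : ∀ v, 1 ≤ s v) (hypos : ∀ v, ∀ i ∈ R, 0 < y v i)
    (hy0 : ∀ v, ∀ i ∉ R, y v i = 0) (hR : R.Nonempty) (hcover : ∀ i, ∃ k, i ∈ Z k) :
    Reach S (20 * ∑ k, (Z k).card)
      ({fun v => sumNorm (W v) (p v) (s v) (y v)} ∪
        {f | ∃ i ∈ R, f = fun v => sumNormGrad (W v) (p v) (s v) (y v) i}) := by
  classical
  have hp0 : ∀ v k, 0 < p v k := fun v k => by linarith [hp1 v k]
  have hs0 : ∀ v, 0 < s v := fun v => by linarith [hs1 v]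
  have hWpos : ∀ v k, ∀ i ∈ Z k, 0 < W v k i := fun v k i hi =>
    lt_of_le_of_ne (hW0 v k i) ((hZ v k i).mp hi).symm
  have hWz : ∀ v k i, i ∉ Z k → W v k i = 0 := fun v k i hi => by
    by_contra h
    exact hi ((hZ v k i).mpr h)
  set K : Finset (Fin d) := Finset.univ.filter fun k => (Z k ∩ R).Nonempty with hK
  set w : ℕ := ∑ k, (Z k).card with hw
  have hKw : K.card ≤ w := by
    rw [Finset.card_eq_sum_ones]
    refine (Finset.sum_le_sum fun k hk => ?_).trans
      (Finset.sum_le_sum_of_subset (f := fun k => (Z k).card) (Finset.subset_univ K))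
    exact Finset.card_pos.mpr ((Finset.mem_filter.mp hk).2.mono Finset.inter_subset_left)
  have hdouble : ∑ i ∈ R, (Finset.univ.filter fun k => i ∈ Z k).card ≤ w := by
    have := Finset.sum_card_bipartiteAbove_eq_sum_card_bipartiteBelow (s := R)
      (t := (Finset.univ : Finset (Fin d))) (fun i k => i ∈ Z k)
    refine this.le.trans (Finset.sum_le_sum fun k _ => Finset.card_le_card fun i hi => ?_)
    exact (Finset.mem_filter.mp hi).2
  have hRw : R.card ≤ w := by
    rw [Finset.card_eq_sum_ones]
    refine (Finset.sum_le_sum fun i _ => ?_).trans hdouble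
    obtain ⟨k, hk⟩ := hcover i
    exact Finset.card_pos.mpr ⟨k, by simpa using hk⟩
  have hw1 : 1 ≤ w := (Finset.card_pos.mpr hR).trans_le hRw
  have hNpos : ∀ v, ∀ k ∈ K, 0 < wNorm (W v k) (p v k) (y v) := fun v k hk => by
    obtain ⟨i, hi⟩ := (Finset.mem_filter.mp hk).2
    rw [Finset.mem_inter] at hi
    exact wNorm_pos (hW0 v k) (hp0 v k) (hWpos v k i hi.1) (hypos v i hi.2).ne'
  have hNzero : ∀ v, ∀ k ∉ K, wNorm (W v k) (p v k) (y v) = 0 := fun v k hk => by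
    rw [wNorm_eq_zero_iff (hW0 v k) (hp0 v k)]
    intro i
    by_contra! h
    refine hk (Finset.mem_filter.mpr ⟨Finset.mem_univ k, i, Finset.mem_inter.mpr
      ⟨(hZ v k i).mpr h.1, ?_⟩⟩)
    by_contra hi
    exact h.2 (hy0 v i hi)
  have hαpos : ∀ v, 0 < sumNorm (W v) (p v) (s v) (y v) := fun v => by
    obtain ⟨i, hi⟩ := hR
    exact sumNorm_pos (hW0 v) (hsum v) (hp1 v) _ fun h => (hypos v i hi).ne' (congrFun h i)
  have one : Reach S 0 {fun _ : V => ((1 : ℕ) : ℝ)} := .of_mem (hlit 1)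
  -- the seminorms
  have hnorms : Reach S (5 * w) {f | ∃ k ∈ K, f = fun v => wNorm (W v k) (p v k) (y v)} := by
    have h1 : ∀ k ∈ K, Reach S (3 * (Z k).card + 2)
        {fun v => wNorm (W v k) (p v k) (y v)} := fun k hk => by
      have h2 := Reach.sum (s := Z k ∩ R) (hlit 0) fun i hi =>
        (Reach.of_mem (hW k i)).mul ((Reach.of_mem (hy i (Finset.mem_inter.mp hi).2)).pow
          (Reach.of_mem (hp k)) fun v => hypos v i (Finset.mem_inter.mp hi).2)
      have h3 : ∀ v, wNorm (W v k) (p v k) (y v) =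
          (∑ i ∈ Z k ∩ R, W v k i * y v i ^ p v k) ^ (((1 : ℕ) : ℝ) / p v k) := fun v => by
        rw [wNorm, Nat.cast_one]
        congr 1
        rw [← Finset.sum_subset (Finset.subset_univ (Z k ∩ R))]
        · refine Finset.sum_congr rfl fun i hi => ?_
          rw [abs_of_pos (hypos v i (Finset.mem_inter.mp hi).2)]
        · intro i _ hi
          by_cases hiZ : i ∈ Z k
          · rw [hy0 v i fun hiR => hi (Finset.mem_inter.mpr ⟨hiZ, hiR⟩), abs_zero,
              Real.zero_rpow (hp0 v k).ne', mul_zero]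
          · rw [hWz v k i hiZ, zero_mul]
      have h4 : ∀ v, 0 < ∑ i ∈ Z k ∩ R, W v k i * y v i ^ p v k := fun v =>
        Finset.sum_pos (fun i hi => mul_pos (hWpos v k i (Finset.mem_inter.mp hi).1)
          (Real.rpow_pos_of_pos (hypos v i (Finset.mem_inter.mp hi).2) _))
          (Finset.mem_filter.mp hk).2
      have h5 := h2.pow (one.div (Reach.of_mem (hp k)) fun v => (hp0 v k).ne') h4
      rw [show (fun v => wNorm (W v k) (p v k) (y v)) = _ from funext h3]
      refine h5.mono_cost ?_
      have := Finset.card_le_card (Finset.inter_subset_left (s₁ := Z k) (s₂ := R))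
      simp only [Finset.sum_const, smul_eq_mul]
      omega
    refine ((Reach.biUnion h1).mono_cost ?_).mono_right ?_
    · rw [Finset.sum_add_distrib, ← Finset.mul_sum, Finset.sum_const, smul_eq_mul]
      have := Finset.sum_le_sum_of_subset (f := fun k => (Z k).card) (Finset.subset_univ K)
      omega
    · rintro f ⟨k, hk, rfl⟩
      exact ⟨k, hk, rfl⟩
  set S₁ := S ∪ {f | ∃ k ∈ K, f = fun v => wNorm (W v k) (p v k) (y v)} with hS₁
  have hSS₁ : S ⊆ S₁ := Set.subset_union_left
  have hN₁ : ∀ k ∈ K, (fun v => wNorm (W v k) (p v k) (y v)) ∈ S₁ := fun k hk =>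
    Or.inr ⟨k, hk, rfl⟩
  -- the norm
  have hnorm : Reach S₁ (4 * w) {fun v => sumNorm (W v) (p v) (s v) (y v)} := by
    have h1 := Reach.sum (s := K) (hSS₁ (hlit 0)) fun k hk =>
      (Reach.of_mem (hN₁ k hk)).pow (Reach.of_mem (hSS₁ hs)) fun v => hNpos v k hk
    have h2 : ∀ v, sumNorm (W v) (p v) (s v) (y v) =
        (∑ k ∈ K, wNorm (W v k) (p v k) (y v) ^ s v) ^ (((1 : ℕ) : ℝ) / s v) := fun v => by
      rw [sumNorm, Nat.cast_one]
      congr 1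
      refine (Finset.sum_subset (Finset.subset_univ K) fun k _ hk => ?_).symm
      rw [hNzero v k hk, Real.zero_rpow (hs0 v).ne']
    have hKne : K.Nonempty := by
      obtain ⟨i, hi⟩ := hR
      obtain ⟨k, hk⟩ := hcover i
      exact ⟨k, Finset.mem_filter.mpr ⟨Finset.mem_univ k, i, Finset.mem_inter.mpr ⟨hk, hi⟩⟩⟩
    have h3 := h1.pow ((one.mono_left hSS₁).div (Reach.of_mem (hSS₁ hs)) fun v => (hs0 v).ne')
      fun v => Finset.sum_pos (fun k hk => Real.rpow_pos_of_pos (hNpos v k hk) _) hKne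
    rw [show (fun v => sumNorm (W v) (p v) (s v) (y v)) = _ from funext h2]
    refine h3.mono_cost ?_
    simp only [Finset.sum_const, smul_eq_mul]
    omega
  set S₂ := S₁ ∪ {fun v => sumNorm (W v) (p v) (s v) (y v)} with hS₂
  have hSS₂ : S ⊆ S₂ := hSS₁.trans Set.subset_union_left
  have hα₂ : (fun v => sumNorm (W v) (p v) (s v) (y v)) ∈ S₂ := Or.inr rfl
  -- the scalar factors
  have hscal : Reach S₂ (4 * w) ({fun v => sumNorm (W v) (p v) (s v) (y v) ^ (((1 : ℕ) : ℝ) - s v)} ∪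
      {f | ∃ k ∈ K, f ∈ ({fun v => wNorm (W v k) (p v k) (y v) ^ (s v - p v k)} :
        Set (V → ℝ))}) := by
    have h1 := (Reach.of_mem hα₂).pow ((one.mono_left hSS₂).sub (Reach.of_mem (hSS₂ hs))) hαpos
    have h2 := Reach.biUnion (s := K) fun k hk => (Reach.of_mem
      (Set.mem_union_left {fun v => sumNorm (W v) (p v) (s v) (y v)} (hN₁ k hk))).pow
      ((Reach.of_mem (hSS₂ hs)).sub (Reach.of_mem (hSS₂ (hp k)))) fun v => hNpos v k hk
    refine (h1.union h2).mono_cost ?_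
    simp only [Finset.sum_const, smul_eq_mul]
    omega
  set S₃ := S₂ ∪ ({fun v => sumNorm (W v) (p v) (s v) (y v) ^ (((1 : ℕ) : ℝ) - s v)} ∪
      {f | ∃ k ∈ K, f ∈ ({fun v => wNorm (W v k) (p v k) (y v) ^ (s v - p v k)} :
        Set (V → ℝ))}) with hS₃
  have hSS₃ : S ⊆ S₃ := hSS₂.trans Set.subset_union_left
  -- the entries of the gradient
  have hgrad : Reach S₃ (7 * w)
      {f | ∃ i ∈ R, f = fun v => sumNormGrad (W v) (p v) (s v) (y v) i} := by
    have h1 : ∀ i ∈ R, Reach S₃ (6 * (Finset.univ.filter fun k => i ∈ Z k).card + 1)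
        {fun v => sumNormGrad (W v) (p v) (s v) (y v) i} := fun i hi => by
      have hyi := Reach.of_mem (hSS₃ (hy i hi))
      have h2 := Reach.sum (s := Finset.univ.filter fun k => i ∈ Z k) (hSS₃ (hlit 0))
        fun k hk => (Reach.of_mem (show (fun v => wNorm (W v k) (p v k) (y v) ^ (s v - p v k)) ∈ S₃
          from Or.inr (Or.inr ⟨k, Finset.mem_filter.mpr ⟨Finset.mem_univ k, i,
            Finset.mem_inter.mpr ⟨(Finset.mem_filter.mp hk).2, hi⟩⟩, rfl⟩))).mul
          ((Reach.of_mem (hSS₃ (hW k i))).mul ((hyi.pow ((Reach.of_mem (hSS₃ (hp k))).sub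
            (Reach.of_mem (hSS₃ (hlit 2)))) fun v => hypos v i hi).mul hyi))
      have h3 := (Reach.of_mem (show (fun v => sumNorm (W v) (p v) (s v) (y v) ^
        (((1 : ℕ) : ℝ) - s v)) ∈ S₃ from Or.inr (Or.inl rfl))).mul h2
      have h4 : ∀ v, sumNormGrad (W v) (p v) (s v) (y v) i =
          sumNorm (W v) (p v) (s v) (y v) ^ (((1 : ℕ) : ℝ) - s v) *
            ∑ k ∈ Finset.univ.filter fun k => i ∈ Z k, wNorm (W v k) (p v k) (y v) ^ (s v - p v k) *
              (W v k i * (y v i ^ (p v k - ((2 : ℕ) : ℝ)) * y v i)) := fun v => by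
        rw [sumNormGrad, abs_of_pos (hypos v i hi), Nat.cast_one, Nat.cast_ofNat]
        congr 1
        refine (Finset.sum_subset (Finset.subset_univ _) fun k _ hk => ?_).symm
        rw [hWz v k i fun h => hk (by simpa using h), zero_mul, mul_zero]
      rw [show (fun v => sumNormGrad (W v) (p v) (s v) (y v) i) = _ from funext h4]
      refine h3.mono_cost ?_
      simp only [Finset.sum_const, smul_eq_mul]
      omega
    refine ((Reach.biUnion h1).mono_cost ?_).mono_right ?_
    · rw [Finset.sum_add_distrib, ← Finset.mul_sum, Finset.sum_const, smul_eq_mul]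
      omega
    · rintro f ⟨i, hi, rfl⟩
      exact ⟨i, hi, rfl⟩
  have hfinal := hnorms.trans (hnorm.trans (hscal.trans hgrad.union_left))
  refine (hfinal.mono_cost (by omega)).mono_right ?_
  rintro f (rfl | hf)
  · exact Or.inl (Or.inl hα₂)
  · exact Or.inr hf

end Costs

section PowerMethodCost

variable {m n d h : ℕ}

/-- Data of the power method with prescribed zero patterns. -/
structure PowerData (m n d h : ℕ) (SA : Finset (Fin m × Fin n)) (Sω : Fin d → Finset (Fin m))
    (Sϖ : Fin h → Finset (Fin n)) where
  A : Matrix (Fin m) (Fin n) ℝ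
  ω : Fin d → Fin m → ℝ
  p : Fin d → ℝ
  s : ℝ
  ϖ : Fin h → Fin n → ℝ
  q : Fin h → ℝ
  t : ℝ
  x₀ : Fin n → ℝ
  A_nonneg : ∀ i j, 0 ≤ A i j
  A_supp : matSupport A = SA
  A_col : ∀ j, ∃ i, 0 < A i j
  ω_nonneg : ∀ k i, 0 ≤ ω k i
  ω_supp : (fun k => vecSupport (ω k)) = Sω
  ω_sum : ∀ i, 0 < ∑ k, ω k i
  one_lt_p : ∀ k, 1 < p k
  one_le_s : 1 ≤ s
  ϖ_nonneg : ∀ k j, 0 ≤ ϖ k j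
  ϖ_supp : (fun k => vecSupport (ϖ k)) = Sϖ
  ϖ_sum : ∀ j, 0 < ∑ k, ϖ k j
  one_lt_q : ∀ k, 1 < q k
  one_le_t : 1 ≤ t
  x₀_pos : ∀ j, 0 < x₀ j

namespace PowerData

variable {SA : Finset (Fin m × Fin n)} {Sω : Fin d → Finset (Fin m)}
  {Sϖ : Fin h → Finset (Fin n)}

def input (v : PowerData m n d h SA Sω Sϖ) : InputName m n d h → ℝ :=
  inputValue v.A v.ω v.p v.s v.ϖ v.q v.t v.x₀

/-- The iterates of the explicit power map, without normalization. -/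
noncomputable def iter (v : PowerData m n d h SA Sω Sϖ) : ℕ → Fin n → ℝ
  | 0 => v.x₀
  | k + 1 => sumPowerMap v.A v.ω v.p v.s v.ϖ v.q v.t (iter v k)

theorem iter_pos (v : PowerData m n d h SA Sω Sϖ) (k : ℕ) : ∀ j, 0 < v.iter k j := by
  induction k with
  | zero => exact v.x₀_pos
  | succ k ih =>
    intro j
    obtain ⟨l, hl⟩ := v.A_col j
    exact sumPowerMap_apply_pos v.A_nonneg v.ω_nonneg v.ω_sum v.one_lt_p v.ϖ_nonneg v.ϖ_sum
      v.one_lt_q (fun i => (ih i).le) hl hl (ih j)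

theorem mem_SA (v : PowerData m n d h SA Sω Sϖ) (i : Fin m) (j : Fin n) :
    (i, j) ∈ SA ↔ v.A i j ≠ 0 :=
  (Iff.of_eq (congrArg ((i, j) ∈ ·) v.A_supp)).symm.trans (by simp [matSupport])

theorem mem_Sω (v : PowerData m n d h SA Sω Sϖ) (k : Fin d) (i : Fin m) :
    i ∈ Sω k ↔ v.ω k i ≠ 0 :=
  (Iff.of_eq (congrArg (i ∈ · k) v.ω_supp)).symm.trans (by simp [vecSupport])

theorem mem_Sϖ (v : PowerData m n d h SA Sω Sϖ) (k : Fin h) (j : Fin n) :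
    j ∈ Sϖ k ↔ v.ϖ k j ≠ 0 :=
  (Iff.of_eq (congrArg (j ∈ · k) v.ϖ_supp)).symm.trans (by simp [vecSupport])

theorem A_pos (v : PowerData m n d h SA Sω Sϖ) {i : Fin m} {j : Fin n} (hij : (i, j) ∈ SA) :
    0 < v.A i j :=
  lt_of_le_of_ne (v.A_nonneg i j) ((v.mem_SA i j).mp hij).symm

theorem exists_mem_Sω (v : PowerData m n d h SA Sω Sϖ) (i : Fin m) : ∃ k, i ∈ Sω k := by
  obtain ⟨k, hk⟩ := exists_weight_pos v.ω_sum i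
  exact ⟨k, (v.mem_Sω k i).mpr hk.ne'⟩

theorem exists_mem_Sϖ (v : PowerData m n d h SA Sω Sϖ) (j : Fin n) : ∃ k, j ∈ Sϖ k := by
  obtain ⟨k, hk⟩ := exists_weight_pos v.ϖ_sum j
  exact ⟨k, (v.mem_Sϖ k j).mpr hk.ne'⟩

/-- The cost of one step, in terms of the zero patterns. -/
def cost (SA : Finset (Fin m × Fin n)) (Sω : Fin d → Finset (Fin m))
    (Sϖ : Fin h → Finset (Fin n)) : ℕ :=
  (∑ k, (Sω k).card) + (∑ k, (Sϖ k).card) + SA.card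

/-- The cost of the norm of the image of a positive vector under `A`, and of its gradient. -/
theorem reach_image (v₀ : PowerData m n d h SA Sω Sϖ) (hn : 0 < n)
    {S : Set (PowerData m n d h SA Sω Sϖ → ℝ)} (hS : initial input ⊆ S)
    {x : PowerData m n d h SA Sω Sϖ → Fin n → ℝ} (hx : ∀ j, (fun v => x v j) ∈ S)
    (hpos : ∀ v j, 0 < x v j) :
    Reach S (2 * SA.card + 20 * ∑ k, (Sω k).card)
      ({fun v => sumNorm v.ω v.p v.s (v.A *ᵥ x v)} ∪
        {f | ∃ i ∈ SA.image Prod.fst,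
          f = fun v => sumNormGrad v.ω v.p v.s (v.A *ᵥ x v) i}) := by
  classical
  have hcard : ∑ i, (Finset.univ.filter fun j => (i, j) ∈ SA).card = SA.card := by
    rw [← Finset.card_sigma]
    refine Finset.card_bij (fun a _ => (a.1, a.2)) ?_ ?_ ?_
    · rintro ⟨i, j⟩ ha
      simpa using ha
    · rintro ⟨i, j⟩ _ ⟨i', j'⟩ _ he
      simp only [Prod.mk.injEq] at he
      obtain ⟨rfl, rfl⟩ := he
      rfl
    · rintro ⟨i, j⟩ hij
      exact ⟨⟨i, j⟩, by simpa using hij, rfl⟩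
  have h1 := reach_mulVec (S := S) (M := fun v : PowerData m n d h SA Sω Sϖ => v.A) (x := x)
    (cols := fun i => Finset.univ.filter fun j => (i, j) ∈ SA)
    (fun c => hS (Or.inr ⟨c, rfl⟩)) (fun i j => hS (Or.inl ⟨.A i j, rfl⟩)) (fun i j _ => hx j)
    (fun v i j hj => by
      by_contra h
      exact hj (by simpa using (v.mem_SA i j).mpr h))
  rw [hcard] at h1
  have h2 := fun hy hy0 hR => reach_sumNormGrad
    (S := S ∪ {f | ∃ i, f = fun v : PowerData m n d h SA Sω Sϖ => (v.A *ᵥ x v) i})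
    (W := fun v => v.ω) (p := fun v => v.p) (s := fun v => v.s)
    (y := fun v => v.A *ᵥ x v) (Z := Sω) (R := SA.image Prod.fst)
    (fun c => Or.inl (hS (Or.inr ⟨c, rfl⟩))) (fun k i => Or.inl (hS (Or.inl ⟨.ω k i, rfl⟩)))
    (fun k => Or.inl (hS (Or.inl ⟨.p k, rfl⟩))) (Or.inl (hS (Or.inl ⟨.s, rfl⟩)))
    (fun i _ => Or.inr ⟨i, rfl⟩) (fun v k i => v.mem_Sω k i) (fun v => v.ω_nonneg)
    (fun v => v.ω_sum) (fun v => v.one_lt_p) (fun v => v.one_le_s) hy hy0 hR v₀.exists_mem_Sω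
  refine h1.trans (h2 (fun v i hi => ?_) (fun v i hi => ?_) ?_)
  · obtain ⟨⟨i, j⟩, hij, rfl⟩ := Finset.mem_image.mp hi
    exact mulVec_apply_pos v.A_nonneg (fun j => (hpos v j).le) (v.A_pos hij) (hpos v j)
  · rw [Matrix.mulVec, dotProduct]
    refine Finset.sum_eq_zero fun j _ => ?_
    have : v.A i j = 0 := by
      by_contra h
      exact hi (Finset.mem_image.mpr ⟨(i, j), (v.mem_SA i j).mpr h, rfl⟩)
    rw [this, zero_mul]
  · obtain ⟨i, hi⟩ := v₀.A_col ⟨0, hn⟩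
    exact ⟨i, Finset.mem_image.mpr ⟨(i, ⟨0, hn⟩), (v₀.mem_SA _ _).mpr hi.ne', rfl⟩⟩

theorem reach_step (v₀ : PowerData m n d h SA Sω Sϖ) (hn : 0 < n)
    {S : Set (PowerData m n d h SA Sω Sϖ → ℝ)} (hS : initial input ⊆ S)
    {x : PowerData m n d h SA Sω Sϖ → Fin n → ℝ} (hx : ∀ j, (fun v => x v j) ∈ S)
    (hpos : ∀ v j, 0 < x v j) :
    Reach S (20 * cost SA Sω Sϖ)
      {f | ∃ j, f = fun v => sumPowerMap v.A v.ω v.p v.s v.ϖ v.q v.t (x v) j} := by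
  classical
  have hcard : ∑ j, (Finset.univ.filter fun i => (i, j) ∈ SA).card = SA.card := by
    rw [← Finset.card_sigma]
    refine Finset.card_bij (fun a _ => (a.2, a.1)) ?_ ?_ ?_
    · rintro ⟨i, j⟩ ha
      simpa using ha
    · rintro ⟨i, j⟩ _ ⟨i', j'⟩ _ he
      simp only [Prod.mk.injEq] at he
      obtain ⟨rfl, rfl⟩ := he
      rfl
    · rintro ⟨i, j⟩ hij
      exact ⟨⟨j, i⟩, by simpa using hij, rfl⟩
  have h1 := reach_image v₀ hn hS hx hpos
  set T := ({fun v => sumNorm v.ω v.p v.s (v.A *ᵥ x v)} ∪ {f | ∃ i ∈ SA.image Prod.fst,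
    f = fun v => sumNormGrad v.ω v.p v.s (v.A *ᵥ x v) i} :
      Set (PowerData m n d h SA Sω Sϖ → ℝ)) with hT
  have h2 := reach_mulVec (S := S ∪ T) (M := fun v => v.Aᵀ)
    (x := fun v => sumNormGrad v.ω v.p v.s (v.A *ᵥ x v))
    (cols := fun j => Finset.univ.filter fun i => (i, j) ∈ SA)
    (fun c => Or.inl (hS (Or.inr ⟨c, rfl⟩))) (fun j i => Or.inl (hS (Or.inl ⟨.A i j, rfl⟩)))
    (fun j i hi => Or.inr (Or.inr ⟨i, Finset.mem_image.mpr ⟨(i, j), by simpa using hi, rfl⟩, rfl⟩))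
    (fun v j i hi => by
      by_contra h
      exact hi (by simpa using (v.mem_SA i j).mpr h))
  rw [hcard] at h2
  have hAx : ∀ v, 0 ≤ v.A *ᵥ x v := fun v => mulVec_nonneg v.A_nonneg fun j => (hpos v j).le
  have h3 := fun hy => reach_sumNormGrad
    (S := (S ∪ T) ∪ {f | ∃ j, f = fun v => (v.Aᵀ *ᵥ sumNormGrad v.ω v.p v.s (v.A *ᵥ x v)) j})
    (W := fun v => v.ϖ) (p := fun v => v.q) (s := fun v => v.t)
    (y := fun v => v.Aᵀ *ᵥ sumNormGrad v.ω v.p v.s (v.A *ᵥ x v)) (R := Finset.univ)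
    (fun c => Or.inl (Or.inl (hS (Or.inr ⟨c, rfl⟩))))
    (fun k i => Or.inl (Or.inl (hS (Or.inl ⟨.ϖ k i, rfl⟩))))
    (fun k => Or.inl (Or.inl (hS (Or.inl ⟨.q k, rfl⟩)))) (Or.inl (Or.inl (hS (Or.inl ⟨.t, rfl⟩))))
    (fun i _ => Or.inr ⟨i, rfl⟩) (fun v k i => v.mem_Sϖ k i) (fun v => v.ϖ_nonneg)
    (fun v => v.ϖ_sum) (fun v => v.one_lt_q) (fun v => v.one_le_t) hy
    (fun v i hi => absurd (Finset.mem_univ i) hi) ⟨(⟨0, hn⟩ : Fin n), Finset.mem_univ _⟩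
    v₀.exists_mem_Sϖ
  have h4 := h1.trans (h2.trans (h3 fun v j _ => by
    obtain ⟨l, hl⟩ := v.A_col j
    exact mulVec_apply_pos (fun i j => v.A_nonneg j i) (sumNormGrad_nonneg v.ω_nonneg (hAx v))
      (show 0 < v.Aᵀ j l from hl) (sumNormGrad_pos v.ω_nonneg v.ω_sum v.one_lt_p (hAx v)
        (mulVec_apply_pos v.A_nonneg (fun j => (hpos v j).le) hl (hpos v j)))))
  refine (h4.mono_cost (by unfold cost; omega)).mono_right ?_
  rintro f ⟨j, rfl⟩
  exact Or.inr ⟨j, Finset.mem_univ j, rfl⟩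

theorem reach_iter (v₀ : PowerData m n d h SA Sω Sϖ) (hn : 0 < n) (k : ℕ) :
    Reach (initial input) (20 * cost SA Sω Sϖ * k)
      {f : PowerData m n d h SA Sω Sϖ → ℝ | ∃ j, f = fun v => v.iter k j} := by
  induction k with
  | zero =>
    refine .base ?_
    rintro f ⟨j, rfl⟩
    exact Or.inl ⟨.x₀ j, rfl⟩
  | succ k ih =>
    rw [mul_add, mul_one]
    exact ih.trans (reach_step v₀ hn (x := fun v => v.iter k) Set.subset_union_left
      (fun j => Or.inr ⟨j, rfl⟩) fun v j => v.iter_pos k j)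

theorem exists_program (hn : 0 < n) (SA : Finset (Fin m × Fin n)) (Sω : Fin d → Finset (Fin m))
    (Sϖ : Fin h → Finset (Fin n)) (k : ℕ) :
    ∃ P : Program (InputName m n d h), ∀ v : PowerData m n d h SA Sω Sϖ,
      P.length ≤ 20 * cost SA Sω Sϖ * (k + 2) ∧
        P.Outputs v.input (List.ofFn (v.iter k) ++ [sumNorm v.ω v.p v.s (v.A *ᵥ v.iter k)]) := by
  obtain he | ⟨⟨v₀⟩⟩ := isEmpty_or_nonempty (PowerData m n d h SA Sω Sϖ)
  · exact ⟨[], fun v => he.elim v⟩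
  have h1 := reach_iter v₀ hn k
  have h2 := h1.trans ((reach_image v₀ hn (x := fun v => v.iter k)
    (S := initial input ∪ {f | ∃ j, f = fun v => v.iter k j}) Set.subset_union_left
    (fun j => Or.inr ⟨j, rfl⟩) fun v j => v.iter_pos k j).union_left)
  obtain ⟨P, hP, hout⟩ := h2.exists_program
    ((List.ofFn fun j => fun v : PowerData m n d h SA Sω Sϖ => v.iter k j) ++
      [fun v => sumNorm v.ω v.p v.s (v.A *ᵥ v.iter k)]) (by
    intro f hf
    rcases List.mem_append.mp hf with hf | hf
    · obtain ⟨j, rfl⟩ := List.mem_ofFn.mp hf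
      exact Or.inl (Or.inr ⟨j, rfl⟩)
    · rw [List.mem_singleton.mp hf]
      exact Or.inr (Or.inl rfl))
  refine ⟨P, fun v => ⟨hP.trans ?_, ?_⟩⟩
  · have hnle : n ≤ ∑ k, (Sϖ k).card := by
      calc n = (Finset.univ : Finset (Fin n)).card := by simp
        _ ≤ (Finset.univ.biUnion Sϖ).card := Finset.card_le_card fun j _ => by
            simpa using v₀.exists_mem_Sϖ j
        _ ≤ _ := Finset.card_biUnion_le
    simp only [List.length_append, List.length_ofFn, List.length_singleton]
    rw [mul_add]
    unfold cost
    omega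
  · simpa [List.map_ofFn, Function.comp_def] using hout v

theorem powerSeq_eq_iter (v : PowerData m n d h SA Sω Sϖ) (hn : 0 < n)
    (hα : NormDifferentiable (sumNorm v.ω v.p v.s))
    (hγ : NormDifferentiable (sumNorm v.ϖ v.q v.t)) (k : ℕ) :
    powerSeq v.A (dualNorm (sumNorm v.ϖ v.q v.t)) (sumNorm v.ω v.p v.s) v.x₀ (k + 1) =
      v.iter (k + 1) := by
  have hS := powerMap_eq_sumPowerMap (A := v.A) hn v.ω_nonneg v.ω_sum v.one_lt_p v.one_le_s
    v.ϖ_nonneg v.ϖ_sum v.one_lt_q v.one_le_t hα hγ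
  induction k with
  | zero =>
    rw [powerSeq, powerSeq, iter, iter, ← hS, powerMap, powerMap, Matrix.mulVec_smul,
      (isMonotoneNorm_sumNorm v.ω_nonneg v.ω_sum v.one_lt_p v.one_le_s).normGradient_smul hα]
    refine inv_pos.mpr (((isMonotoneNorm_sumNorm v.ϖ_nonneg v.ϖ_sum v.one_lt_q
      v.one_le_t).dualNorm hn).pos fun h => ?_)
    exact (v.x₀_pos ⟨0, hn⟩).ne' (congrFun h _)
  | succ k ih => rw [powerSeq, ih, hS]; rfl

end PowerData

end PowerMethodCost

theorem mainTheorem8 :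
    -- `c` is an absolute constant; the programs `P` know only the dimensions, the zero patterns
    -- of `A`, `ω`, `ϖ` and the number of iterations
    ∃ c : ℕ, ∀ m n d h : ℕ,
      ∃ P : Finset (Fin m × Fin n) → (Fin d → Finset (Fin m)) → (Fin h → Finset (Fin n)) →
          ℕ → Program (InputName m n d h),
      ∀ (A : Matrix (Fin m) (Fin n) ℝ)
        (ω : Fin d → Fin m → ℝ) (p : Fin d → ℝ) (s : ℝ)
        (ϖ : Fin h → Fin n → ℝ) (q : Fin h → ℝ) (t : ℝ),
        0 < n →
        (∀ i j, 0 ≤ A i j) → (Aᵀ * A).IsIrreducible →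
        (∀ k i, 0 ≤ ω k i) → (∀ i, 0 < ∑ k, ω k i) → (∀ k, 1 < p k) → 1 ≤ s →
        (∀ k j, 0 ≤ ϖ k j) → (∀ j, 0 < ∑ k, ϖ k j) → (∀ k, 1 < q k) → 1 ≤ t →
        NormDifferentiable (sumNorm ω p s) → NormDifferentiable (sumNorm ϖ q t) →
        tauBound A p s q t < 1 →
        ∀ (α : (Fin m → ℝ) → ℝ) (β : (Fin n → ℝ) → ℝ) (prog : ℕ → Program (InputName m n d h)),
        α = sumNorm ω p s → β = dualNorm (sumNorm ϖ q t) →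
        prog = P (matSupport A) (fun k => vecSupport (ω k)) (fun k => vecSupport (ϖ k)) →
        -- the norm `β` on the domain is the minimum over decompositions
        (1 < t → ∀ x, IsLeast
          (splitValues (fun k => dualWeight (ϖ k) (q k)) (fun k => (q k).conjExponent)
            t.conjExponent x) (β x)) ∧
        -- the induced norm is a maximum
        IsGreatest (normQuotients A β α) (inducedNorm A β α) ∧
        -- the explicit formula for the iterator
        (∀ x, powerMap A β α x = sumNormGrad ϖ q t (Aᵀ *ᵥ sumNormGrad ω p s (A *ᵥ x))) ∧
        ∀ x₀ : Fin n → ℝ, (∀ j, 0 < x₀ j) →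
          -- `k` iterations, and the value `α(A x_k)`, cost at most `c * C(S_A) * k` operations
          (∀ k : ℕ, 1 ≤ k →
            (prog k).length ≤ c * iterCost A ω ϖ * k ∧
            (prog k).Outputs (inputValue A ω p s ϖ q t x₀)
              (List.ofFn (powerSeq A β α x₀ k) ++ [α (A *ᵥ powerSeq A β α x₀ k)])) ∧
          -- `O(ln (1/ε))` iterations suffice for precision `ε`
          ∃ K : ℝ, 0 < K ∧ ∀ ε : ℝ, 0 < ε → ε ≤ 1 / 2 →
            ∃ k : ℕ, 1 ≤ k ∧ (k : ℝ) ≤ K * Real.log (1 / ε) ∧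
              ((prog k).length : ℝ) ≤ c * iterCost A ω ϖ * (K * Real.log (1 / ε)) ∧
              ∀ l : ℕ, k ≤ l →
                inducedNorm A β α - ε ≤ α (A *ᵥ powerSeq A β α x₀ l) ∧
                α (A *ᵥ powerSeq A β α x₀ l) ≤ inducedNorm A β α := by

  refine ⟨60, fun m n d h => ?_⟩
  rcases Nat.eq_zero_or_pos n with hn0 | hn
  · refine ⟨fun _ _ _ _ => [], ?_⟩
    intro A ω p s ϖ q t hn
    omega
  choose P hP using fun (SA : Finset (Fin m × Fin n)) (Sω : Fin d → Finset (Fin m))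
    (Sϖ : Fin h → Finset (Fin n)) (k : ℕ) => PowerData.exists_program hn SA Sω Sϖ k
  refine ⟨P, ?_⟩
  rintro A ω p s ϖ q t - hA hirr hω hωs hp hs hϖ hϖs hq ht hα hγ hτ α β prog rfl rfl rfl
  have hαN := isMonotoneNorm_sumNorm hω hωs hp hs
  have hβN := (isMonotoneNorm_sumNorm hϖ hϖs hq ht).dualNorm hn
  refine ⟨fun ht1 x => isLeast_splitValues hn hϖ hϖs hq ht1 hγ x,
    isGreatest_inducedNorm hαN hβN hn A,
    powerMap_eq_sumPowerMap hn hω hωs hp hs hϖ hϖs hq ht hα hγ, fun x₀ hx₀ => ?_⟩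
  let v : PowerData m n d h (matSupport A) (fun k => vecSupport (ω k))
      (fun k => vecSupport (ϖ k)) :=
    ⟨A, ω, p, s, ϖ, q, t, x₀, hA, rfl, exists_pos_of_isIrreducible hA hirr, hω, rfl, hωs, hp, hs,
      hϖ, rfl, hϖs, hq, ht, hx₀⟩
  have hlen : ∀ k : ℕ, 1 ≤ k → (P (matSupport A) (fun k => vecSupport (ω k))
      (fun k => vecSupport (ϖ k)) k).length ≤ 60 * iterCost A ω ϖ * k := fun k hk =>
    ((hP _ _ _ k v).1).trans (by
      change 20 * iterCost A ω ϖ * (k + 2) ≤ _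
      nlinarith [Nat.mul_le_mul_left (iterCost A ω ϖ) hk])
  refine ⟨fun k hk => ⟨hlen k hk, ?_⟩, ?_⟩
  · obtain ⟨k, rfl⟩ := Nat.exists_eq_add_of_le' hk
    rw [show powerSeq A (dualNorm (sumNorm ϖ q t)) (sumNorm ω p s) x₀ (k + 1) = v.iter (k + 1)
      from v.powerSeq_eq_iter hn hα hγ k]
    exact (hP _ _ _ (k + 1) v).2
  · obtain ⟨ρ, R, hρ0, hρ1, hR, hconv⟩ := powerSeq_linear_convergence hn hA hirr hω hωs hp hs
      hϖ hϖs hq ht hα hγ hτ hx₀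
    obtain ⟨K, hK, hsteps⟩ := exists_log_steps hρ0 hρ1 hR
    refine ⟨K, hK, fun ε hε hε2 => ?_⟩
    obtain ⟨k, hk1, hkK, hl⟩ := hsteps ε hε hε2
    refine ⟨k, hk1, hkK, ?_, fun l hkl => ⟨?_, (hconv l).2⟩⟩
    · calc _ ≤ ((60 * iterCost A ω ϖ * k : ℕ) : ℝ) := Nat.cast_le.mpr (hlen k hk1)
        _ = (60 : ℕ) * iterCost A ω ϖ * (k : ℝ) := by push_cast; ring
        _ ≤ _ := mul_le_mul_of_nonneg_left hkK (by positivity)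
    · linarith [(hconv l).1, hl l hkl]
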